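/- Let $|\rho|<1$ and let $(X_t)_{t\in\mathbb Z}$ be a stationary first-order autoregressive process, $X_t=\rho X_{t-1}+\sqrt{1-\rho^2}\,\varepsilon_t$, where $(\varepsilon_t)_{t\in\mathbb Z}$ are independent $N(0,1)$ variables. Let $S_4=\#\{i: 1\le i<4,\ X_iX_{i+1}<0\}$ be the number of sign changes in $(X_1,X_2,X_3,X_4)$ and, for $e\in\{0,1\}^4$, let $p_e=\mathbb P\{(-1)^{e_i}X_i<0 \text{ for } i=1,\dots,4\}$. Put $$I(h,x)=\int_0^x \arcsin\!\left(\frac{(1-h^2)\,t}{h^2-t^2}\right)\frac{dt}{\sqrt{1-t^2}},$$ $$f(a,b)=\frac1{16}+\frac{2\arcsin a+\arcsin b+2\arcsin(ab)+\arcsin(a^2b)}{8\pi}+\frac{\arcsin(a)^2+I(a,a^2b)}{4\pi^2},$$ $$g(a,b)=\frac1{16}+\frac{\arcsin b-\arcsin(a^2b)}{8\pi}-\frac{\arcsin(a)^2+I(a,a^2b)}{4\pi^2}$$ (with $I(0,0)=0$). (1) For all real $a,b$ with $|a|<1$ and $|b|<1$, the matrices $$R^{+}=\begin{pmatrix}1&a&ab&a^2b\\a&1&b&ab\\ab&b&1&a\\a^2b&ab&a&1\end{pmatrix},\qquad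 R^{-}=\begin{pmatrix}1&-a&-ab&-a^2b\\-a&1&b&ab\\-ab&b&1&a\\-a^2b&ab&a&1\end{pmatrix}$$ are positive definite, and a centred Gaussian vector in $\mathbb R^4$ with covariance matrix $R^{+}$ (respectively $R^{-}$) has all four coordinates positive with probability $f(a,b)$ (respectively $g(a,b)$). (2) The sixteen sign-pattern probabilities are $$p_{1111}=p_{0000}=f(\rho,\rho),\qquad p_{1000}=p_{0111}=g(\rho,\rho)=g(-\rho,\rho)=p_{0001}=p_{1110},$$ $$p_{0100}=p_{1011}=g(\rho,-\rho)=g(-\rho,-\rho)=p_{0010}=p_{1101},$$ $$p_{1100}=p_{0011}=f(\rho,-\rho),\qquad p_{0110}=p_{1001}=f(-\rho,\rho),\qquad p_{1010}=p_{0101}=f(-\rho,-\rho).$$ (3) $S_4$ is square integrable, and $$\mathbb E(S_4)=4g(\rho,\rho)+2f(\rho,-\rho)+8g(\rho,-\rho)+4f(-\rho,\rho)+6f(-\rho,-\rho)=\frac{3\arccos\rho}{\pi},$$ $$\mathbb V(S_4)=4g(\rho,\rho)+2f(\rho,-\rho)+16g(\rho,-\rho)+8f(-\rho,\rho)+18f(-\rho,-\rho)-9\left[\frac12-\frac{\arcsin\rho}{\pi}\right]^2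 .$$ -/

import Mathlib

open MeasureTheory ProbabilityTheory

noncomputable section

namespace AROne

/-- `X` is a stationary first-order autoregressive process, indexed by all integers, with
parameter `ρ` and driven by the standard Gaussian white noise `ε`:
`X_t = ρ X_{t-1} + √(1 - ρ²) ε_t`. -/
structure IsStationaryAR1 {Ω : Type*} [MeasurableSpace Ω] (P : Measure Ω) (ρ : ℝ)
    (ε X : ℤ → Ω → ℝ) : Prop where
  /-- The noise variables are standard normal. -/
  noise_law : ∀ t, HasLaw (ε t) (gaussianReal 0 1) P
  /-- The noise variables are independent. -/
  noise_indep : iIndepFun ε P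
  measurable : ∀ t, Measurable (X t)
  /-- The autoregressive recursion. -/
  recursion : ∀ t, ∀ᵐ ω ∂P, X t ω = ρ * X (t - 1) ω + Real.sqrt (1 - ρ ^ 2) * ε t ω
  /-- (Strict) stationarity: the law of the process is invariant under time shifts. -/
  stationary : ∀ h : ℤ, IdentDistrib (fun ω t => X (t + h) ω) (fun ω t => X t ω) P P

/-- The segment `(X_1, …, X_n)`. -/
def segment {Ω : Type*} (X : ℤ → Ω → ℝ) (n : ℕ) : Fin n → Ω → ℝ :=
  fun i => X ((i : ℤ) + 1)

/-- The number of sign changes `S_n = #{i : 1 ≤ i < n, X_i X_{i+1} < 0}`. -/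
def signChanges {Ω : Type*} (X : ℤ → Ω → ℝ) (n : ℕ) (ω : Ω) : ℕ :=
  ((Finset.Ico (1 : ℤ) n).filter fun i => X i ω * X (i + 1) ω < 0).card

/-- `p_e = ℙ{(-1)^{e_i} Y_i < 0 for all i}` for a random vector `Y` and a vector `e` of bits. -/
def signPatternProb {Ω : Type*} [MeasurableSpace Ω] (P : Measure Ω) {n : ℕ}
    (Y : Fin n → Ω → ℝ) (e : Fin n → Fin 2) : ℝ :=
  P.real {ω | ∀ i, (-1 : ℝ) ^ (e i : ℕ) * Y i ω < 0}

/-- `p_e(R)`: the probability `p_e` for a centred Gaussian vector with covariance matrix `R`. -/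
def gaussianOrthantProb {n : ℕ} (R : Matrix (Fin n) (Fin n) ℝ) (e : Fin n → Fin 2) : ℝ :=
  signPatternProb (multivariateGaussian 0 R) (fun i (x : EuclideanSpace ℝ (Fin n)) => x i) e

/-- The covariance matrix `R⁺`. -/
def Rplus (a b : ℝ) : Matrix (Fin 4) (Fin 4) ℝ :=
  !![1, a, a * b, a ^ 2 * b;
     a, 1, b, a * b;
     a * b, b, 1, a;
     a ^ 2 * b, a * b, a, 1]

/-- The covariance matrix `R⁻`. -/
def Rminus (a b : ℝ) : Matrix (Fin 4) (Fin 4) ℝ :=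
  !![1, -a, -(a * b), -(a ^ 2 * b);
     -a, 1, b, a * b;
     -(a * b), b, 1, a;
     -(a ^ 2 * b), a * b, a, 1]

/-- Cheng's integral `I(h, x) = ∫₀ˣ arcsin((1 - h²) t / (h² - t²)) / √(1 - t²) dt`. -/
def chengI (h x : ℝ) : ℝ :=
  ∫ t in (0 : ℝ)..x,
    Real.arcsin ((1 - h ^ 2) * t / (h ^ 2 - t ^ 2)) * (1 / Real.sqrt (1 - t ^ 2))

/-- The explicit expression `f(a, b)`. -/
def f (a b : ℝ) : ℝ :=
  1 / 16
    + (2 * Real.arcsin a + Real.arcsin b + 2 * Real.arcsin (a * b) + Real.arcsin (a ^ 2 * b))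
        / (8 * Real.pi)
    + (Real.arcsin a ^ 2 + chengI a (a ^ 2 * b)) / (4 * Real.pi ^ 2)

/-- The explicit expression `g(a, b)`. -/
def g (a b : ℝ) : ℝ :=
  1 / 16
    + (Real.arcsin b - Real.arcsin (a ^ 2 * b)) / (8 * Real.pi)
    - (Real.arcsin a ^ 2 + chengI a (a ^ 2 * b)) / (4 * Real.pi ^ 2)

end AROne

end

/-!
The signs `sᵢ` of a centred Gaussian vector in `ℝ⁴` are almost surely `±1`, and the vector is
symmetric, so expanding `∏ (1 ± sᵢ) / 2` expresses every orthant probability through the six moments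
`E (sᵢ sⱼ)` and the single moment `E (s₁ s₂ s₃ s₄)` (`gaussianOrthantProb_eq`). The former are
`(2 / π) arcsin Rᵢⱼ` by Sheppard's formula (`integral_sign_mul_sign_bvn`); the content is
the latter.

Under `R⁺(a, b)` the vector is a Markov chain
`(a X + √(1 - a²) Z₁, X, Y, a Y + √(1 - a²) Z₄)`, with `(X, Y)` bivariate normal of correlation `b`
(`map_model`). Conditioning on `(X, Y)` gives `E (s₁ s₂ s₃ s₄) = E (H |X| H |Y|)`, where
`H x = ∫₀ˣ 2 κ φ(κ u) du`, `κ = a / √(1 - a²)` and `φ` is the normal density. By Fubini this is the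
mixture of the probabilities `P(|X| > u, |Y| > v)` with weight `4 κ² φ(κ u) φ(κ v)`. Plackett's
identity, `d/ds P(X > u, Y > v) = p_s(u, v)` for the density `p_s` with correlation `s`, is
`quadrant_eq`; it holds because the derivative in `s` of the conditional tail is a total derivative
in `x`. It turns the moment into its value `((2 / π) arcsin a)²` at `b = 0` plus an integral over
`s` from `0` to `b`. There `φ(κ u) φ(κ v) p_s(u, v)` is, up to a constant, again a bivariate normal
density, of correlation `(1 - a²) s / (1 - a² s²)` (`stdPDF_mul_bvnPDF`), so its quadrant integrals
are arcsines, and `t = a² s` gives the integral `chengI a (a² b)` (`integral_signCorr_mul_eq`).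
Changing the sign of the first coordinate leads from `R⁺` to `R⁻`.

For the autoregressive process, iterating the recursion writes `X₁` as a finite combination of past
noise plus `ρⁿ X_{1-n}`, which tends to `0` in probability by stationarity; characteristic functions
then show that `(X₁, …, X₄)` is Gaussian with covariance matrix `R⁺(ρ, ρ)`
(`IsStationaryAR1.map_segment`). Almost surely the number of sign changes is
`(3 - s₁ s₂ - s₂ s₃ - s₃ s₄) / 2`, so its first two moments are again combinations of the sign
moments.
-/

noncomputable section

namespace AROne

open Set Filter Topology

/-! ### Plackett's identity for the bivariate normal law -/

/-- The standard normal density. -/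
def stdPDF (x : ℝ) : ℝ := (Real.sqrt (2 * Real.pi))⁻¹ * Real.exp (-x ^ 2 / 2)

/-- The upper tail of the standard normal distribution. -/
def tail (x : ℝ) : ℝ := ∫ t in Ioi x, stdPDF t

/-- The density of the standard bivariate normal distribution with correlation `r`. -/
def bvnPDF (r x y : ℝ) : ℝ :=
  (2 * Real.pi * Real.sqrt (1 - r ^ 2))⁻¹
    * Real.exp (-(x ^ 2 - 2 * r * x * y + y ^ 2) / (2 * (1 - r ^ 2)))

lemma stdPDF_eq_gaussianPDFReal : stdPDF = gaussianPDFReal 0 1 := by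
  ext x; simp [stdPDF, gaussianPDFReal]

lemma stdPDF_pos (x : ℝ) : 0 < stdPDF x := by unfold stdPDF; positivity

lemma stdPDF_neg (x : ℝ) : stdPDF (-x) = stdPDF x := by simp [stdPDF]

lemma continuous_stdPDF : Continuous stdPDF := by unfold stdPDF; fun_prop

lemma integrable_stdPDF : Integrable stdPDF :=
  stdPDF_eq_gaussianPDFReal ▸ integrable_gaussianPDFReal 0 1

lemma integral_stdPDF : ∫ x, stdPDF x = 1 :=
  stdPDF_eq_gaussianPDFReal ▸ integral_gaussianPDFReal_eq_one 0 one_ne_zero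

lemma integrable_mul_stdPDF : Integrable fun x => x * stdPDF x := by
  have h := (integrable_mul_exp_neg_mul_sq (b := 1 / 2) (by norm_num)).const_mul
    (Real.sqrt (2 * Real.pi))⁻¹
  refine h.congr (ae_of_all _ fun x => ?_)
  simp only [stdPDF]
  rw [show -(1 / 2) * x ^ 2 = -x ^ 2 / 2 by ring]
  ring

lemma hasDerivAt_stdPDF (x : ℝ) : HasDerivAt stdPDF (-(x * stdPDF x)) x := by
  have h : HasDerivAt (fun x : ℝ => -x ^ 2 / 2) (-x) x := by
    have := ((hasDerivAt_pow 2 x).neg).div_const 2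
    convert! this using 1
    norm_num; ring
  have := (h.exp).const_mul (Real.sqrt (2 * Real.pi))⁻¹
  convert! this using 1
  simp only [stdPDF]; ring

lemma tendsto_stdPDF_atTop : Tendsto stdPDF atTop (𝓝 0) := by
  have h : Tendsto (fun x : ℝ => -x ^ 2 / 2) atTop atBot := by
    have h1 : Tendsto (fun x : ℝ => x ^ 2 / 2) atTop atTop :=
      (tendsto_pow_atTop two_ne_zero).atTop_div_const (by norm_num)
    refine (tendsto_neg_atTop_atBot.comp h1).congr fun x => ?_
    simp only [Function.comp]; ring
  have := (Real.tendsto_exp_atBot.comp h).const_mul (Real.sqrt (2 * Real.pi))⁻¹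
  rw [mul_zero] at this
  exact this

lemma tail_nonneg (x : ℝ) : 0 ≤ tail x :=
  setIntegral_nonneg measurableSet_Ioi fun t _ => (stdPDF_pos t).le

lemma tail_le_one (x : ℝ) : tail x ≤ 1 := by
  rw [← integral_stdPDF]
  exact setIntegral_le_integral integrable_stdPDF (ae_of_all _ fun t => (stdPDF_pos t).le)

lemma hasDerivAt_tail (x : ℝ) : HasDerivAt tail (-stdPDF x) x := by
  have h : ∀ y, tail y = tail x - ∫ t in x..y, stdPDF t := fun y => by
    have := intervalIntegral.integral_Ioi_sub_Ioi' (a := x) (b := y)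
      integrable_stdPDF.integrableOn integrable_stdPDF.integrableOn
    simp only [tail]; linarith
  have h2 := (continuous_stdPDF.integral_hasStrictDerivAt x x).hasDerivAt.const_sub (tail x)
  exact h2.congr_of_eventuallyEq (Eventually.of_forall h)

lemma continuous_tail : Continuous tail :=
  continuous_iff_continuousAt.2 fun x => (hasDerivAt_tail x).continuousAt

lemma tail_neg (x : ℝ) : tail (-x) = 1 - tail x := by
  have h1 : ∫ t in Iic x, stdPDF t = tail (-x) := by
    have := integral_comp_neg_Iic x stdPDF
    simp only [stdPDF_neg] at this
    exact this
  have h2 := intervalIntegral.integral_Iic_add_Ioi (b := x) (f := stdPDF) (μ := volume)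
    integrable_stdPDF.integrableOn integrable_stdPDF.integrableOn
  rw [integral_stdPDF, h1] at h2
  simp only [tail] at *; linarith

lemma tail_zero : tail 0 = 1 / 2 := by
  have := tail_neg 0
  rw [neg_zero] at this; linarith

lemma one_sub_sq_pos {r : ℝ} (hr : |r| < 1) : 0 < 1 - r ^ 2 := by
  have := (sq_lt_one_iff_abs_lt_one r).2 hr; linarith

/-- The bivariate density factors into a marginal and a conditional density. -/
lemma bvnPDF_eq {r : ℝ} (hr : |r| < 1) (x y : ℝ) :
    bvnPDF r x y = stdPDF x *
      (stdPDF ((y - r * x) / Real.sqrt (1 - r ^ 2)) / Real.sqrt (1 - r ^ 2)) := by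
  have h := one_sub_sq_pos hr
  have hs := Real.sqrt_pos.2 h
  have hs2 := Real.sq_sqrt h.le
  have hp := Real.sqrt_pos.2 Real.two_pi_pos
  have hp2 := Real.mul_self_sqrt Real.two_pi_pos.le
  unfold bvnPDF stdPDF
  have he : Real.exp (-(x ^ 2 - 2 * r * x * y + y ^ 2) / (2 * (1 - r ^ 2)))
      = Real.exp (-x ^ 2 / 2) *
        Real.exp (-((y - r * x) / Real.sqrt (1 - r ^ 2)) ^ 2 / 2) := by
    rw [← Real.exp_add, div_pow, hs2]
    congr 1; field_simp; ring
  rw [he]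
  rw [show (2 * Real.pi) = Real.sqrt (2 * Real.pi) ^ 2 by rw [sq, hp2],
    Real.sqrt_sq hp.le]
  field_simp

lemma bvnPDF_symm (r x y : ℝ) : bvnPDF r x y = bvnPDF r y x := by
  unfold bvnPDF; congr 2; ring

lemma bvnPDF_pos {r : ℝ} (hr : |r| < 1) (x y : ℝ) : 0 < bvnPDF r x y := by
  have := Real.sqrt_pos.2 (one_sub_sq_pos hr)
  unfold bvnPDF; positivity

/-- A Gaussian bound on the bivariate density, uniform over correlations bounded away from `±1`. -/
lemma bvnPDF_le {B s : ℝ} (hB : B < 1) (hs : |s| ≤ B) (x y : ℝ) :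
    bvnPDF s x y ≤ (2 * Real.pi * Real.sqrt (1 - B ^ 2))⁻¹
      * Real.exp (-(x ^ 2 + y ^ 2) / 4) := by
  have hB0 : 0 ≤ B := (abs_nonneg s).trans hs
  have h1 := one_sub_sq_pos (hs.trans_lt hB)
  have h2 := one_sub_sq_pos (r := B) (by rwa [abs_of_nonneg hB0])
  have hsq : s ^ 2 ≤ B ^ 2 := by rw [← sq_abs s]; gcongr
  unfold bvnPDF
  have := Real.sqrt_pos.2 h2
  refine mul_le_mul (by gcongr) (Real.exp_le_exp.2 ?_) (Real.exp_pos _).le (by positivity)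
  rw [div_le_div_iff₀ (by positivity) (by norm_num)]
  have e1 : s * x * y * 2 ≤ |s| * (x ^ 2 + y ^ 2) := by
    have h3 : s * x * y ≤ |s| * |x * y| := by rw [← abs_mul, ← mul_assoc]; exact le_abs_self _
    have h4 : |x * y| * 2 ≤ x ^ 2 + y ^ 2 := by
      rw [abs_mul, ← sq_abs x, ← sq_abs y]; nlinarith [sq_nonneg (|x| - |y|)]
    nlinarith [abs_nonneg s]
  have e2 : 1 - s ^ 2 = (1 - |s|) * (1 + |s|) := by rw [← sq_abs s]; ring
  have e3 : 0 < 1 - |s| := by linarith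
  rw [e2]
  have e4 : 0 ≤ x ^ 2 + y ^ 2 := by positivity
  have e5 : (1 - |s|) * (1 + |s|) * (x ^ 2 + y ^ 2) ≤ (1 - |s|) * 2 * (x ^ 2 + y ^ 2) := by
    gcongr; linarith
  nlinarith

lemma hasDerivAt_cond_tail {s : ℝ} (hs : |s| < 1) (x v : ℝ) :
    HasDerivAt (fun s => stdPDF x * tail ((v - s * x) / Real.sqrt (1 - s ^ 2)))
      (bvnPDF s x v * ((x - s * v) / (1 - s ^ 2))) s := by
  have h := one_sub_sq_pos hs
  have hq := Real.sqrt_pos.2 h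
  have hq2 := Real.sq_sqrt h.le
  have d1 : HasDerivAt (fun s : ℝ => v - s * x) (-x) s := by
    simpa using ((hasDerivAt_id s).mul_const x).const_sub v
  have d2 : HasDerivAt (fun s : ℝ => 1 - s ^ 2) (-(2 * s)) s := by
    simpa using (hasDerivAt_pow 2 s).const_sub 1
  have d3 := (d1.div (d2.sqrt h.ne') hq.ne')
  have d4 := ((hasDerivAt_tail _).comp s d3).const_mul (stdPDF x)
  refine d4.congr_deriv ?_
  rw [bvnPDF_eq hs, Pi.div_apply]
  set q := Real.sqrt (1 - s ^ 2)
  rw [← hq2]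
  field_simp
  have : q ^ 2 = 1 - s ^ 2 := hq2
  rw [this]; ring

lemma hasDerivAt_bvnPDF {s : ℝ} (hs : |s| < 1) (x v : ℝ) :
    HasDerivAt (fun x => -bvnPDF s x v) (bvnPDF s x v * ((x - s * v) / (1 - s ^ 2))) x := by
  have h := one_sub_sq_pos hs
  have hq := Real.sqrt_pos.2 h
  have hq2 := Real.sq_sqrt h.le
  simp_rw [fun x => bvnPDF_symm s x v, bvnPDF_eq hs v]
  have d1 : HasDerivAt (fun x : ℝ => (x - s * v) / Real.sqrt (1 - s ^ 2))
      (1 / Real.sqrt (1 - s ^ 2)) x := ((hasDerivAt_id x).sub_const _).div_const _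
  have d2 := ((((hasDerivAt_stdPDF _).comp x d1).div_const (Real.sqrt (1 - s ^ 2))).const_mul
    (stdPDF v)).neg
  refine d2.congr_deriv ?_
  set q := Real.sqrt (1 - s ^ 2)
  rw [← hq2]
  field_simp

lemma tendsto_bvnPDF {s : ℝ} (hs : |s| < 1) (v : ℝ) :
    Tendsto (fun x => -bvnPDF s x v) atTop (𝓝 0) := by
  have hq := Real.sqrt_pos.2 (one_sub_sq_pos hs)
  simp_rw [fun x => bvnPDF_symm s x v, bvnPDF_eq hs v]
  have h1 : Tendsto (fun x : ℝ => (x - s * v) / Real.sqrt (1 - s ^ 2)) atTop atTop :=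
    (tendsto_atTop_add_const_right _ _ tendsto_id).atTop_div_const hq
  simpa using (((tendsto_stdPDF_atTop.comp h1).div_const (Real.sqrt (1 - s ^ 2))).const_mul
    (stdPDF v)).neg

lemma continuousOn_bvnPDF {B : ℝ} (hB : B < 1) :
    ContinuousOn (fun p : ℝ × ℝ × ℝ => bvnPDF p.1 p.2.1 p.2.2) (Icc (-B) B ×ˢ univ) := by
  have h : ∀ p ∈ Icc (-B) B ×ˢ (univ : Set (ℝ × ℝ)), 0 < 1 - p.1 ^ 2 := fun p hp =>
    one_sub_sq_pos ((abs_le.2 hp.1).trans_lt hB)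
  unfold bvnPDF
  refine ContinuousOn.mul (ContinuousOn.inv₀ (by fun_prop) fun p hp => ?_)
    (Real.continuous_exp.comp_continuousOn
      (ContinuousOn.div (by fun_prop) (by fun_prop) fun p hp => ?_))
  · have := Real.sqrt_pos.2 (h p hp); positivity
  · have := h p hp; positivity

lemma measurable_bvnPDF : Measurable fun p : ℝ × ℝ × ℝ => bvnPDF p.1 p.2.1 p.2.2 := by
  unfold bvnPDF; fun_prop

lemma abs_le_of_mem_uIoc {s b : ℝ} (hs : s ∈ uIoc 0 b) : |s| ≤ |b| := by
  rcases le_total 0 b with h | h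
  · rw [uIoc_of_le h] at hs
    rw [abs_of_pos hs.1, abs_of_nonneg h]; exact hs.2
  · rw [uIoc_of_ge h] at hs
    rw [abs_of_nonpos hs.2, abs_of_nonpos h]; linarith [hs.1]

lemma abs_le_of_mem_uIcc {s b : ℝ} (hs : s ∈ uIcc 0 b) : |s| ≤ |b| := by
  have := abs_sub_left_of_mem_uIcc hs
  simpa using this

lemma integrable_plackett {b : ℝ} (hb : |b| < 1) (u v : ℝ) :
    Integrable (Function.uncurry fun s x => bvnPDF s x v * ((x - s * v) / (1 - s ^ 2)))
      ((volume.restrict (uIoc 0 b)).prod (volume.restrict (Ioi u))) := by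
  have hbb := one_sub_sq_pos hb
  have : IsFiniteMeasure (volume.restrict (uIoc 0 b)) := ⟨by simp [uIoc]⟩
  have i1 : Integrable fun x : ℝ => (|x| + |v|) * Real.exp (-x ^ 2 / 4) := by
    have h1 := (integrable_mul_exp_neg_mul_sq (b := 1 / 4) (by norm_num)).abs
    have h2 := (integrable_exp_neg_mul_sq (b := 1 / 4) (by norm_num)).const_mul |v|
    refine (h1.add h2).congr (ae_of_all _ fun x => ?_)
    simp only [Pi.add_apply, abs_mul, Real.abs_exp]
    rw [show -(1 / 4) * x ^ 2 = -x ^ 2 / 4 by ring]; ring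
  have i2 := (i1.const_mul ((2 * Real.pi * Real.sqrt (1 - |b| ^ 2))⁻¹ / (1 - b ^ 2))).restrict
    (s := Ioi u)
  have i3 := i2.comp_snd (volume.restrict (uIoc 0 b))
  refine i3.mono' ?_ ?_
  · refine Measurable.aestronglyMeasurable ?_
    have : Measurable fun p : ℝ × ℝ => bvnPDF p.1 p.2 v :=
      measurable_bvnPDF.comp (by fun_prop : Measurable fun p : ℝ × ℝ => (p.1, p.2, v))
    simp only [Function.uncurry_def]
    fun_prop
  · rw [Measure.prod_restrict]
    filter_upwards [ae_restrict_mem (measurableSet_uIoc.prod measurableSet_Ioi)] with p hp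
    obtain ⟨s, x⟩ := p
    have hs : |s| ≤ |b| := abs_le_of_mem_uIoc hp.1
    have hs1 := hs.trans_lt hb
    have hss := one_sub_sq_pos hs1
    have hsq : s ^ 2 ≤ b ^ 2 := sq_le_sq.2 hs
    simp only [Function.uncurry_apply_pair, Real.norm_eq_abs, abs_mul, abs_div,
      abs_of_pos (bvnPDF_pos hs1 x v), abs_of_pos hss]
    have e1 := bvnPDF_le hb hs x v
    have e2 : Real.exp (-(x ^ 2 + v ^ 2) / 4) ≤ Real.exp (-x ^ 2 / 4) :=
      Real.exp_le_exp.2 (by nlinarith [sq_nonneg v])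
    have e3 : |x - s * v| ≤ |x| + |v| := by
      refine (abs_sub _ _).trans ?_
      rw [abs_mul]
      have := mul_le_mul_of_nonneg_right hs1.le (abs_nonneg v)
      linarith
    have hpos : 0 ≤ (2 * Real.pi * Real.sqrt (1 - |b| ^ 2))⁻¹ := by positivity
    calc bvnPDF s x v * (|x - s * v| / (1 - s ^ 2))
        ≤ ((2 * Real.pi * Real.sqrt (1 - |b| ^ 2))⁻¹ * Real.exp (-x ^ 2 / 4))
          * ((|x| + |v|) / (1 - b ^ 2)) := by
          have h5 := e1.trans (mul_le_mul_of_nonneg_left e2 hpos)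
          gcongr
      _ = _ := by ring

/-- Plackett's identity in integrated form: the quadrant probability of a standard bivariate
normal vector, here written by conditioning on the first coordinate, is the primitive of the
density with respect to the correlation. -/
theorem quadrant_eq {b : ℝ} (hb : |b| < 1) (u v : ℝ) :
    ∫ x in Ioi u, stdPDF x * tail ((v - b * x) / Real.sqrt (1 - b ^ 2))
      = tail u * tail v + ∫ s in (0 : ℝ)..b, bvnPDF s u v := by
  have hs1 : ∀ s ∈ uIcc 0 b, |s| < 1 := fun s hs => (abs_le_of_mem_uIcc hs).trans_lt hb
  -- the derivative in `s` is the derivative in `x` of minus the density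
  have key : ∀ s, |s| < 1 → ∫ x in Ioi u, bvnPDF s x v * ((x - s * v) / (1 - s ^ 2))
      = bvnPDF s u v := by
    intro s hs
    have hq := Real.sqrt_pos.2 (one_sub_sq_pos hs)
    have := integral_Ioi_of_hasDerivAt_of_tendsto' (a := u)
      (fun x _ => hasDerivAt_bvnPDF hs x v) ?_ (tendsto_bvnPDF hs v)
    · simpa using this
    · refine Integrable.integrableOn ?_
      have h1 := (((integrable_mul_stdPDF.comp_div hq.ne').comp_sub_right (s * v)).const_mul
        (stdPDF v / (1 - s ^ 2)))
      refine h1.congr (ae_of_all _ fun x => ?_)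
      have h := one_sub_sq_pos hs
      have hq2 := Real.sq_sqrt h.le
      simp only
      rw [bvnPDF_symm, bvnPDF_eq hs v]
      field_simp
  have ftc : ∀ x, ∫ s in (0 : ℝ)..b, bvnPDF s x v * ((x - s * v) / (1 - s ^ 2))
      = stdPDF x * tail ((v - b * x) / Real.sqrt (1 - b ^ 2)) - stdPDF x * tail v := by
    intro x
    rw [intervalIntegral.integral_eq_sub_of_hasDerivAt
      (fun s hs => hasDerivAt_cond_tail (hs1 s hs) x v)]
    · simp
    · refine ContinuousOn.intervalIntegrable ?_
      have hsub : MapsTo (fun s : ℝ => (s, x, v)) (uIcc 0 b) (Icc (-|b|) |b| ×ˢ univ) :=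
        fun s hs => ⟨abs_le.1 (abs_le_of_mem_uIcc hs), mem_univ _⟩
      have c1 := (continuousOn_bvnPDF hb).comp
        (by fun_prop : ContinuousOn (fun s : ℝ => (s, x, v)) (uIcc 0 b)) hsub
      refine ContinuousOn.mul c1 (ContinuousOn.div (by fun_prop) (by fun_prop) fun s hs => ?_)
      exact (one_sub_sq_pos (hs1 s hs)).ne'
  have i1 : IntegrableOn (fun x => stdPDF x * tail v) (Ioi u) :=
    (integrable_stdPDF.mul_const _).integrableOn
  have i2 : IntegrableOn (fun x => stdPDF x * tail ((v - b * x) / Real.sqrt (1 - b ^ 2)))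
      (Ioi u) := by
    refine Integrable.integrableOn (integrable_stdPDF.mono' ?_ (ae_of_all _ fun x => ?_))
    · have := continuous_tail; have := continuous_stdPDF
      exact Continuous.aestronglyMeasurable (by fun_prop)
    · rw [Real.norm_eq_abs, abs_of_nonneg (mul_nonneg (stdPDF_pos x).le (tail_nonneg _))]
      exact mul_le_of_le_one_right (stdPDF_pos x).le (tail_le_one _)
  have swap := intervalIntegral_integral_swap (integrable_plackett hb u v)
  rw [intervalIntegral.integral_congr fun s hs => key s (hs1 s hs)] at swap
  simp_rw [ftc] at swap
  rw [integral_sub i2 i1, integral_mul_const] at swap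
  change _ = _ - tail u * tail v at swap
  linarith

/-! ### Sheppard's formula -/

/-- The standard bivariate normal law with correlation `r`, as the law of
`(x, r x + √(1 - r²) w)` for independent standard normal `x` and `w`. -/
def bvn (r : ℝ) : Measure (ℝ × ℝ) :=
  ((gaussianReal 0 1).prod (gaussianReal 0 1)).map
    fun p => (p.1, r * p.1 + Real.sqrt (1 - r ^ 2) * p.2)

lemma measurable_bvn_map (r : ℝ) :
    Measurable fun p : ℝ × ℝ => (p.1, r * p.1 + Real.sqrt (1 - r ^ 2) * p.2) := by fun_prop

instance (r : ℝ) : IsProbabilityMeasure (bvn r) :=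
  Measure.isProbabilityMeasure_map (measurable_bvn_map r).aemeasurable

lemma measurePreserving_neg_gaussian :
    MeasurePreserving (fun x : ℝ => -x) (gaussianReal 0 1) (gaussianReal 0 1) :=
  ⟨measurable_neg, by rw [gaussianReal_map_neg, neg_zero]⟩

lemma gaussianReal_real_Ioi (x : ℝ) : (gaussianReal 0 1).real (Ioi x) = tail x := by
  rw [← integral_indicator_one measurableSet_Ioi,
    integral_gaussianReal_eq_integral_smul one_ne_zero, ← stdPDF_eq_gaussianPDFReal, tail,
    ← integral_indicator measurableSet_Ioi]
  congr 1; ext t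
  by_cases h : t ∈ Ioi x <;> simp [h]

lemma gaussianReal_real_Iio (x : ℝ) : (gaussianReal 0 1).real (Iio x) = tail (-x) := by
  rw [← gaussianReal_real_Ioi]
  have h := measurePreserving_neg_gaussian.measureReal_preimage
    (measurableSet_Ioi (a := -x)).nullMeasurableSet
  rw [← h]; congr 1; ext t; simp

lemma map_neg_bvn (r : ℝ) : (bvn r).map (fun p => (-p.1, -p.2)) = bvn r := by
  have h := (measurePreserving_neg_gaussian.prod measurePreserving_neg_gaussian).map_eq
  rw [bvn, Measure.map_map (by fun_prop) (by fun_prop)]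
  conv_rhs => rw [← h, Measure.map_map (by fun_prop) (by fun_prop)]
  congr 1; ext p
  · rfl
  · simp; ring

lemma map_snd_neg_bvn (r : ℝ) : (bvn r).map (fun p => (p.1, -p.2)) = bvn (-r) := by
  have h := ((MeasurePreserving.id (gaussianReal 0 1)).prod measurePreserving_neg_gaussian).map_eq
  rw [bvn, bvn, Measure.map_map (by fun_prop) (by fun_prop)]
  conv_rhs => rw [← h, Measure.map_map (by fun_prop) (by fun_prop)]
  congr 1; ext p
  · rfl
  · simp; ring

lemma bvn_real_Ioi_Ioi {r : ℝ} (hr : |r| < 1) (u v : ℝ) :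
    (bvn r).real (Ioi u ×ˢ Ioi v) = tail u * tail v + ∫ s in (0 : ℝ)..r, bvnPDF s u v := by
  have hq := Real.sqrt_pos.2 (one_sub_sq_pos hr)
  have hm : MeasurableSet (Ioi u ×ˢ Ioi v : Set (ℝ × ℝ)) :=
    measurableSet_Ioi.prod measurableSet_Ioi
  rw [← quadrant_eq hr, bvn, map_measureReal_apply (measurable_bvn_map r) hm,
    ← integral_indicator_one ((measurable_bvn_map r) hm), integral_prod]
  · rw [integral_gaussianReal_eq_integral_smul one_ne_zero, ← stdPDF_eq_gaussianPDFReal,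
      ← integral_indicator measurableSet_Ioi]
    congr 1; ext x
    by_cases hx : u < x
    · rw [indicator_of_mem (mem_Ioi.2 hx), smul_eq_mul, ← gaussianReal_real_Ioi,
        ← integral_indicator_one measurableSet_Ioi]
      congr 2; ext w
      simp only [indicator, mem_preimage, mem_prod, mem_Ioi, hx, true_and, Pi.one_apply,
        div_lt_iff₀ hq, sub_lt_iff_lt_add']
      rw [mul_comm w]
    · rw [indicator_of_notMem (by simpa using hx)]
      simp [indicator, hx]
  · exact (integrable_const (1 : ℝ)).indicator ((measurable_bvn_map r) hm)

lemma bvn_real_Iio_Iio {r : ℝ} (hr : |r| < 1) (u v : ℝ) :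
    (bvn r).real (Iio (-u) ×ˢ Iio (-v)) = tail u * tail v + ∫ s in (0 : ℝ)..r, bvnPDF s u v := by
  rw [← bvn_real_Ioi_Ioi hr]
  conv_rhs => rw [← map_neg_bvn, map_measureReal_apply (by fun_prop)
    (measurableSet_Ioi.prod measurableSet_Ioi)]
  congr 1; ext p; simp [lt_neg]

lemma bvn_real_Ioi_Iio {r : ℝ} (hr : |r| < 1) (u v : ℝ) :
    (bvn r).real (Ioi u ×ˢ Iio (-v)) = tail u * tail v - ∫ s in (0 : ℝ)..r, bvnPDF (-s) u v := by
  have h1 : (bvn (-r)).real (Ioi u ×ˢ Ioi v) = (bvn r).real (Ioi u ×ˢ Iio (-v)) := by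
    rw [← map_snd_neg_bvn, map_measureReal_apply (by fun_prop)
      (measurableSet_Ioi.prod measurableSet_Ioi)]
    congr 1; ext p; simp [lt_neg]
  rw [← h1, bvn_real_Ioi_Ioi (by rwa [abs_neg]),
    intervalIntegral.integral_comp_neg (fun s => bvnPDF s u v), neg_zero,
    intervalIntegral.integral_symm (-r) 0]
  ring

lemma bvn_real_Iio_Ioi {r : ℝ} (hr : |r| < 1) (u v : ℝ) :
    (bvn r).real (Iio (-u) ×ˢ Ioi v) = tail u * tail v - ∫ s in (0 : ℝ)..r, bvnPDF (-s) u v := by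
  rw [← bvn_real_Ioi_Iio hr]
  conv_rhs => rw [← map_neg_bvn, map_measureReal_apply (by fun_prop)
    (measurableSet_Ioi.prod measurableSet_Iio)]
  congr 1; ext p; simp [lt_neg]

lemma intervalIntegrable_bvnPDF {r : ℝ} (hr : |r| < 1) (u v : ℝ) :
    IntervalIntegrable (fun s => bvnPDF s u v) volume 0 r := by
  have hsub : MapsTo (fun s : ℝ => (s, u, v)) (uIcc 0 r) (Icc (-|r|) |r| ×ˢ univ) :=
    fun s hs => ⟨abs_le.1 (abs_le_of_mem_uIcc hs), mem_univ _⟩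
  have c1 := (continuousOn_bvnPDF hr).comp
    (by fun_prop : ContinuousOn (fun s : ℝ => (s, u, v)) (uIcc 0 r)) hsub
  exact c1.intervalIntegrable

lemma intervalIntegrable_bvnPDF_neg {r : ℝ} (hr : |r| < 1) (u v : ℝ) :
    IntervalIntegrable (fun s => bvnPDF (-s) u v) volume 0 r := by
  have h := (intervalIntegrable_bvnPDF (r := -r) (by rwa [abs_neg]) u v).comp_sub_left 0
  simpa using h

/-- The probability that both coordinates are large in absolute value. -/
lemma bvn_real_abs {r : ℝ} (hr : |r| < 1) {u v : ℝ} (hu : 0 ≤ u) (hv : 0 ≤ v) :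
    (bvn r).real {p | u < |p.1| ∧ v < |p.2|} =
      4 * (tail u * tail v) + 2 * ∫ s in (0 : ℝ)..r, (bvnPDF s u v - bvnPDF (-s) u v) := by
  have e : {p : ℝ × ℝ | u < |p.1| ∧ v < |p.2|} =
      (Ioi u ×ˢ Ioi v ∪ Ioi u ×ˢ Iio (-v)) ∪ (Iio (-u) ×ˢ Ioi v ∪ Iio (-u) ×ˢ Iio (-v)) := by
    ext p
    simp only [mem_ofPred_eq, lt_abs, mem_union, mem_prod, mem_Ioi, mem_Iio, lt_neg (a := u),
      lt_neg (a := v)]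
    tauto
  have m1 : ∀ a : ℝ, MeasurableSet (Ioi a) := fun _ => measurableSet_Ioi
  have m2 : ∀ a : ℝ, MeasurableSet (Iio a) := fun _ => measurableSet_Iio
  have d : ∀ a : ℝ, 0 ≤ a → Disjoint (Ioi a) (Iio (-a)) := fun a ha =>
    Set.disjoint_left.2 fun x hx hx' => by
      simp only [mem_Ioi, mem_Iio] at hx hx'; linarith
  rw [e, measureReal_union _ (by measurability), measureReal_union _ (by measurability),
    measureReal_union _ (by measurability),
    bvn_real_Ioi_Ioi hr, bvn_real_Ioi_Iio hr, bvn_real_Iio_Ioi hr, bvn_real_Iio_Iio hr,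
    intervalIntegral.integral_sub (intervalIntegrable_bvnPDF hr u v)
      (intervalIntegrable_bvnPDF_neg hr u v)]
  · ring
  · exact Set.Disjoint.set_prod_right (d v hv) _ _
  · exact Set.Disjoint.set_prod_right (d v hv) _ _
  · rw [← prod_union, ← prod_union]
    exact Set.Disjoint.set_prod_left (d u hu) _ _

lemma integral_bvnPDF_zero {r : ℝ} (hr : |r| < 1) :
    ∫ s in (0 : ℝ)..r, bvnPDF s 0 0 = Real.arcsin r / (2 * Real.pi) := by
  have h := intervalIntegral.integral_eq_sub_of_hasDerivAt
    (f := fun s => Real.arcsin s / (2 * Real.pi)) (f' := fun s => bvnPDF s 0 0)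
    (a := 0) (b := r) (fun s hs => ?_) (intervalIntegrable_bvnPDF hr 0 0)
  · simpa using h
  · have hs1 : |s| < 1 := (abs_le_of_mem_uIcc hs).trans_lt hr
    have := (Real.hasDerivAt_arcsin (x := s) (by rintro rfl; simp at hs1)
      (by rintro rfl; simp at hs1)).div_const (2 * Real.pi)
    refine this.congr_deriv ?_
    simp [bvnPDF]; ring

lemma measurable_sign : Measurable Real.sign := by
  unfold Real.sign
  exact Measurable.ite measurableSet_Iio measurable_const
    (Measurable.ite measurableSet_Ioi measurable_const measurable_const)

lemma abs_sign_le (x : ℝ) : |Real.sign x| ≤ 1 := by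
  rcases Real.sign_apply_eq x with h | h | h <;> simp [h]

/-- Sheppard's formula. -/
theorem integral_sign_mul_sign_bvn {r : ℝ} (hr : |r| < 1) :
    ∫ p, Real.sign p.1 * Real.sign p.2 ∂(bvn r) = 2 / Real.pi * Real.arcsin r := by
  have e : ∀ p : ℝ × ℝ, Real.sign p.1 * Real.sign p.2 =
      ((Ioi 0 ×ˢ Ioi 0).indicator 1 p + (Iio 0 ×ˢ Iio 0).indicator 1 p)
      - ((Ioi 0 ×ˢ Iio 0).indicator 1 p + (Iio 0 ×ˢ Ioi 0).indicator 1 p) := by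
    rintro ⟨x, y⟩
    simp only [indicator, mem_prod, mem_Ioi, mem_Iio, Pi.one_apply]
    rcases lt_trichotomy x 0 with hx | hx | hx <;> rcases lt_trichotomy y 0 with hy | hy | hy <;>
      simp [hx, hy, hx.le, hy.le, not_lt.2, Real.sign_of_neg, Real.sign_of_pos]
  have m1 : ∀ a : ℝ, MeasurableSet (Ioi a) := fun _ => measurableSet_Ioi
  have m2 : ∀ a : ℝ, MeasurableSet (Iio a) := fun _ => measurableSet_Iio
  have i : ∀ s : Set (ℝ × ℝ), MeasurableSet s →
      Integrable (fun p => s.indicator (1 : ℝ × ℝ → ℝ) p) (bvn r) := fun s hs =>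
    (integrable_const (1 : ℝ)).indicator hs
  simp_rw [e]
  have i1 := i _ ((m1 0).prod (m1 0))
  have i2 := i _ ((m2 0).prod (m2 0))
  have i3 := i _ ((m1 0).prod (m2 0))
  have i4 := i _ ((m2 0).prod (m1 0))
  rw [integral_sub (by exact i1.add i2) (by exact i3.add i4), integral_add i1 i2,
    integral_add i3 i4,
    integral_indicator_one ((m1 _).prod (m1 _)), integral_indicator_one ((m2 _).prod (m2 _)),
    integral_indicator_one ((m1 _).prod (m2 _)), integral_indicator_one ((m2 _).prod (m1 _))]
  have h1 := bvn_real_Ioi_Ioi hr 0 0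
  have h2 := bvn_real_Iio_Iio hr 0 0
  have h3 := bvn_real_Ioi_Iio hr 0 0
  have h4 := bvn_real_Iio_Ioi hr 0 0
  have h5 : ∫ s in (0 : ℝ)..r, bvnPDF (-s) 0 0 = ∫ s in (0 : ℝ)..r, bvnPDF s 0 0 := by
    congr 1; ext s; simp [bvnPDF]
  rw [h5] at h3 h4
  rw [integral_bvnPDF_zero hr] at h1 h2 h3 h4
  rw [neg_zero] at h2 h3 h4
  rw [h1, h2, h3, h4]
  field_simp; ring

/-- The conditional expectation of the sign of a standard normal variable with correlation `a` to
another one, given the value `x` of the latter. -/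
lemma integral_sign_gaussian {a : ℝ} (ha : |a| < 1) (x : ℝ) :
    ∫ z, Real.sign (a * x + Real.sqrt (1 - a ^ 2) * z) ∂(gaussianReal 0 1) =
      tail (-(a / Real.sqrt (1 - a ^ 2) * x)) - tail (a / Real.sqrt (1 - a ^ 2) * x) := by
  have hq := Real.sqrt_pos.2 (one_sub_sq_pos ha)
  set q := Real.sqrt (1 - a ^ 2)
  set k := a / q with hk
  have hax : ∀ z, a * x + q * z = q * (z - -(k * x)) := fun z => by
    rw [hk]; field_simp; ring
  have e : ∀ z, Real.sign (a * x + q * z) =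
      (Ioi (-(k * x))).indicator 1 z - (Iio (-(k * x))).indicator 1 z := by
    intro z
    rw [hax z]
    simp only [indicator, mem_Ioi, mem_Iio, Pi.one_apply]
    rcases lt_trichotomy z (-(k * x)) with h | h | h
    · rw [Real.sign_of_neg (mul_neg_of_pos_of_neg hq (sub_neg.2 h))]
      simp [h, not_lt.2 h.le]
    · simp [h]
    · rw [Real.sign_of_pos (mul_pos hq (sub_pos.2 h))]
      simp [h, not_lt.2 h.le]
  simp_rw [e]
  rw [integral_sub (by exact (integrable_const (1 : ℝ)).indicator measurableSet_Ioi)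
      (by exact (integrable_const (1 : ℝ)).indicator measurableSet_Iio),
    integral_indicator_one measurableSet_Ioi, integral_indicator_one measurableSet_Iio,
    gaussianReal_real_Ioi, gaussianReal_real_Iio, neg_neg]

lemma integral_two_mul_stdPDF (k x : ℝ) :
    ∫ t in (0 : ℝ)..x, 2 * k * stdPDF (k * t) = tail (-(k * x)) - tail (k * x) := by
  have hd : ∀ t, HasDerivAt (fun t => tail (-(k * t)) - tail (k * t))
      (2 * k * stdPDF (k * t)) t := fun t => by
    have d1 : HasDerivAt (fun t => k * t) k t := by simpa using (hasDerivAt_id t).const_mul k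
    refine (((hasDerivAt_tail _).comp t d1.neg).sub ((hasDerivAt_tail _).comp t d1)).congr_deriv ?_
    simp only [Pi.neg_apply, stdPDF_neg]; ring
  have := continuous_stdPDF
  rw [intervalIntegral.integral_eq_sub_of_hasDerivAt (fun t _ => hd t)
    (Continuous.intervalIntegrable (by fun_prop) _ _)]
  simp

/-- The even function `x ↦ sign x * E (sign Y | X = x)` as a mixture of indicators of
`{|x| > t}`. -/
lemma integral_indicator_lt_abs (k x : ℝ) :
    ∫ t in Ioi (0 : ℝ), 2 * k * stdPDF (k * t) * (Iio |x|).indicator 1 t =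
      Real.sign x * (tail (-(k * x)) - tail (k * x)) := by
  have h1 : ∫ t in Ioi (0 : ℝ), 2 * k * stdPDF (k * t) * (Iio |x|).indicator 1 t =
      ∫ t in (0 : ℝ)..|x|, 2 * k * stdPDF (k * t) := by
    rw [intervalIntegral.integral_of_le (abs_nonneg x), integral_Ioc_eq_integral_Ioo,
      ← Ioi_inter_Iio, ← setIntegral_indicator measurableSet_Iio]
    congr 1; ext t
    by_cases h : t ∈ Iio |x| <;> simp [h]
  rw [h1, integral_two_mul_stdPDF]
  rcases lt_trichotomy x 0 with h | h | h
  · rw [abs_of_neg h, Real.sign_of_neg h]; simp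
  · simp [h]
  · rw [abs_of_pos h, Real.sign_of_pos h]; simp

/-! ### The product moment behind the fourth-order sign moment -/

/-- Lebesgue measure on the open positive quadrant. -/
def quadrantVolume : Measure (ℝ × ℝ) :=
  (volume.restrict (Ioi (0 : ℝ))).prod (volume.restrict (Ioi (0 : ℝ)))

instance : SFinite quadrantVolume := by unfold quadrantVolume; infer_instance

lemma ae_quadrantVolume : ∀ᵐ q ∂quadrantVolume, 0 < q.1 ∧ 0 < q.2 := by
  rw [quadrantVolume, Measure.prod_restrict]
  filter_upwards [ae_restrict_mem (measurableSet_Ioi.prod measurableSet_Ioi)] with q hq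
  exact hq

lemma integrable_bvnPDF_quadrant {r : ℝ} (hr : |r| < 1) :
    Integrable (fun q : ℝ × ℝ => bvnPDF r q.1 q.2) quadrantVolume := by
  have i1 : Integrable (fun x : ℝ => Real.exp (-(1 / 4) * x ^ 2)) (volume.restrict (Ioi 0)) :=
    (integrable_exp_neg_mul_sq (by norm_num)).restrict
  have i2 := (i1.mul_prod i1).const_mul (2 * Real.pi * Real.sqrt (1 - |r| ^ 2))⁻¹
  refine Integrable.mono' i2 ?_ (ae_of_all _ fun q => ?_)
  · exact (measurable_bvnPDF.comp
      (by fun_prop : Measurable fun q : ℝ × ℝ => (r, q.1, q.2))).aestronglyMeasurable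
  · rw [Real.norm_eq_abs, abs_of_pos (bvnPDF_pos hr _ _)]
    refine (bvnPDF_le hr le_rfl _ _).trans (le_of_eq ?_)
    rw [← Real.exp_add]
    congr 2; ring

lemma integral_bvnPDF_Ioi {r : ℝ} (hr : |r| < 1) (x : ℝ) :
    ∫ y in Ioi 0, bvnPDF r x y = stdPDF x * tail ((0 - r * x) / Real.sqrt (1 - r ^ 2)) := by
  have hq := Real.sqrt_pos.2 (one_sub_sq_pos hr)
  simp_rw [bvnPDF_eq hr, integral_const_mul, integral_div]
  congr 1
  have h1 := integral_comp_mul_left_Ioi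
    (fun y => stdPDF (y + (0 - r * x) / Real.sqrt (1 - r ^ 2))) 0 (inv_pos.2 hq)
  have h2 : ∫ y in Ioi 0, stdPDF (y + (0 - r * x) / Real.sqrt (1 - r ^ 2)) =
      tail ((0 - r * x) / Real.sqrt (1 - r ^ 2)) := by
    rw [tail, ← integral_indicator measurableSet_Ioi, ← integral_indicator measurableSet_Ioi,
      ← integral_add_right_eq_self (indicator (Ioi ((0 - r * x) / Real.sqrt (1 - r ^ 2))) _)
        ((0 - r * x) / Real.sqrt (1 - r ^ 2))]
    congr 1; ext y
    simp [indicator]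
  rw [mul_zero, h2, inv_inv, smul_eq_mul] at h1
  have h3 : (fun y => stdPDF ((y - r * x) / Real.sqrt (1 - r ^ 2))) = fun y =>
      stdPDF ((Real.sqrt (1 - r ^ 2))⁻¹ * y + (0 - r * x) / Real.sqrt (1 - r ^ 2)) := by
    funext y; congr 1; field_simp; ring
  rw [h3, h1]
  field_simp

/-- The mass that the bivariate normal density gives to the positive quadrant, with the
coordinates rescaled by a common factor. -/
lemma integral_bvnPDF_quadrant {r l : ℝ} (hr : |r| < 1) (hl : 0 < l) :
    ∫ u in Ioi 0, ∫ v in Ioi 0, bvnPDF r (l * u) (l * v) =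
      (1 / 4 + Real.arcsin r / (2 * Real.pi)) / l ^ 2 := by
  have h1 : ∀ u, ∫ v in Ioi 0, bvnPDF r (l * u) (l * v) =
      l⁻¹ * (stdPDF (l * u) * tail ((0 - r * (l * u)) / Real.sqrt (1 - r ^ 2))) := fun u => by
    rw [integral_comp_mul_left_Ioi (fun v => bvnPDF r (l * u) v) 0 hl, mul_zero,
      integral_bvnPDF_Ioi hr, smul_eq_mul]
  simp_rw [h1, integral_const_mul]
  rw [integral_comp_mul_left_Ioi
    (fun u => stdPDF u * tail ((0 - r * u) / Real.sqrt (1 - r ^ 2))) 0 hl, mul_zero,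
    quadrant_eq hr, integral_bvnPDF_zero hr, tail_zero, smul_eq_mul]
  field_simp; ring

section Tilt

variable {a s : ℝ}

lemma one_sub_mul_pos (ha : |a| < 1) (hs : |s| < 1) : 0 < 1 - a ^ 2 * s ^ 2 := by
  have := one_sub_sq_pos (r := a * s) (by
    rw [abs_mul]; exact mul_lt_one_of_nonneg_of_lt_one_left (abs_nonneg _) ha hs.le)
  rwa [mul_pow] at this

lemma abs_sq_mul_lt_one (ha : |a| < 1) (hs : |s| < 1) : |a ^ 2 * s| < 1 := by
  rw [abs_mul, abs_pow, sq_abs]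
  exact mul_lt_one_of_nonneg_of_lt_one_left (sq_nonneg _) ((sq_lt_one_iff_abs_lt_one a).2 ha) hs.le

lemma one_sub_sq_tilt (ha : |a| < 1) (hs : |s| < 1) :
    1 - ((1 - a ^ 2) * s / (1 - a ^ 2 * s ^ 2)) ^ 2 =
      (1 - s ^ 2) * (1 - (a ^ 2 * s) ^ 2) / (1 - a ^ 2 * s ^ 2) ^ 2 := by
  have := one_sub_mul_pos ha hs
  field_simp; ring

lemma abs_tilt_lt_one (ha : |a| < 1) (hs : |s| < 1) :
    |(1 - a ^ 2) * s / (1 - a ^ 2 * s ^ 2)| < 1 := by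
  rw [← sq_lt_one_iff_abs_lt_one, ← sub_pos, one_sub_sq_tilt ha hs]
  have := one_sub_mul_pos ha hs
  have := one_sub_sq_pos hs
  have := one_sub_sq_pos (abs_sq_mul_lt_one ha hs)
  positivity

/-- Weighting a bivariate normal density of correlation `s` by a Gaussian factor in each
coordinate gives, up to a constant, a rescaled bivariate normal density of correlation
`(1 - a²) s / (1 - a² s²)`. -/
lemma stdPDF_mul_bvnPDF (ha : |a| < 1) (hs : |s| < 1) (u v : ℝ) :
    stdPDF (a / Real.sqrt (1 - a ^ 2) * u) * stdPDF (a / Real.sqrt (1 - a ^ 2) * v)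
        * bvnPDF s u v =
      Real.sqrt (1 - (a ^ 2 * s) ^ 2) / (2 * Real.pi * (1 - a ^ 2 * s ^ 2)) *
        bvnPDF ((1 - a ^ 2) * s / (1 - a ^ 2 * s ^ 2))
          (Real.sqrt ((1 - (a ^ 2 * s) ^ 2) / ((1 - a ^ 2) * (1 - a ^ 2 * s ^ 2))) * u)
          (Real.sqrt ((1 - (a ^ 2 * s) ^ 2) / ((1 - a ^ 2) * (1 - a ^ 2 * s ^ 2))) * v) := by
  have p1 := one_sub_mul_pos ha hs
  have p2 := one_sub_sq_pos hs
  have p3 := one_sub_sq_pos (abs_sq_mul_lt_one ha hs)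
  have p4 := one_sub_sq_pos ha
  have q2 := Real.sqrt_pos.2 p2
  have q3 := Real.sqrt_pos.2 p3
  set l := Real.sqrt ((1 - (a ^ 2 * s) ^ 2) / ((1 - a ^ 2) * (1 - a ^ 2 * s ^ 2))) with hl
  have hl2 : l ^ 2 = (1 - (a ^ 2 * s) ^ 2) / ((1 - a ^ 2) * (1 - a ^ 2 * s ^ 2)) :=
    Real.sq_sqrt (by positivity)
  set k := a / Real.sqrt (1 - a ^ 2) with hk
  have hk2 : k ^ 2 = a ^ 2 / (1 - a ^ 2) := by rw [hk, div_pow, Real.sq_sqrt p4.le]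
  have hsq : Real.sqrt (1 - ((1 - a ^ 2) * s / (1 - a ^ 2 * s ^ 2)) ^ 2) =
      Real.sqrt (1 - s ^ 2) * Real.sqrt (1 - (a ^ 2 * s) ^ 2) / (1 - a ^ 2 * s ^ 2) := by
    rw [one_sub_sq_tilt ha hs, Real.sqrt_div' _ (by positivity), Real.sqrt_sq p1.le,
      Real.sqrt_mul p2.le]
  unfold bvnPDF stdPDF
  rw [hsq, one_sub_sq_tilt ha hs]
  have hx : Real.exp (-(k * u) ^ 2 / 2) * Real.exp (-(k * v) ^ 2 / 2) *
      Real.exp (-(u ^ 2 - 2 * s * u * v + v ^ 2) / (2 * (1 - s ^ 2))) =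
      Real.exp (-((l * u) ^ 2 - 2 * ((1 - a ^ 2) * s / (1 - a ^ 2 * s ^ 2)) * (l * u) * (l * v)
        + (l * v) ^ 2) /
        (2 * ((1 - s ^ 2) * (1 - (a ^ 2 * s) ^ 2) / (1 - a ^ 2 * s ^ 2) ^ 2))) := by
    rw [← Real.exp_add, ← Real.exp_add]
    congr 1
    have e1 : -((l * u) ^ 2 - 2 * ((1 - a ^ 2) * s / (1 - a ^ 2 * s ^ 2)) * (l * u) * (l * v)
        + (l * v) ^ 2) = -(l ^ 2) * (u ^ 2 -
          2 * ((1 - a ^ 2) * s / (1 - a ^ 2 * s ^ 2)) * u * v + v ^ 2) := by ring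
    rw [e1, hl2, mul_pow, mul_pow, hk2]
    generalize 1 - (a ^ 2 * s) ^ 2 = N at p3
    field_simp
    ring
  rw [← hx]
  have hp2 := Real.mul_self_sqrt Real.two_pi_pos.le
  have hp := Real.sqrt_pos.2 Real.two_pi_pos
  have hc : (Real.sqrt (2 * Real.pi))⁻¹ * (Real.sqrt (2 * Real.pi))⁻¹ = (2 * Real.pi)⁻¹ := by
    rw [← mul_inv, hp2]
  calc _ = ((Real.sqrt (2 * Real.pi))⁻¹ * (Real.sqrt (2 * Real.pi))⁻¹) *
        (2 * Real.pi * Real.sqrt (1 - s ^ 2))⁻¹ * (Real.exp (-(k * u) ^ 2 / 2) *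
        Real.exp (-(k * v) ^ 2 / 2) *
        Real.exp (-(u ^ 2 - 2 * s * u * v + v ^ 2) / (2 * (1 - s ^ 2)))) := by ring
    _ = _ := by
      rw [hc]
      generalize Real.sqrt (1 - (a ^ 2 * s) ^ 2) = N at q3
      generalize 1 - a ^ 2 * s ^ 2 = M at p1
      field_simp

lemma integral_stdPDF_mul_bvnPDF (ha : |a| < 1) (hs : |s| < 1) :
    ∫ q, stdPDF (a / Real.sqrt (1 - a ^ 2) * q.1) * stdPDF (a / Real.sqrt (1 - a ^ 2) * q.2)
        * bvnPDF s q.1 q.2 ∂quadrantVolume =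
      (1 - a ^ 2) / (2 * Real.pi * Real.sqrt (1 - (a ^ 2 * s) ^ 2)) *
        (1 / 4 + Real.arcsin ((1 - a ^ 2) * s / (1 - a ^ 2 * s ^ 2)) / (2 * Real.pi)) := by
  have p1 := one_sub_mul_pos ha hs
  have p3 := one_sub_sq_pos (abs_sq_mul_lt_one ha hs)
  have p4 := one_sub_sq_pos ha
  have q3 := Real.sqrt_pos.2 p3
  have q32 := Real.sq_sqrt p3.le
  rw [quadrantVolume, integral_prod]
  · simp_rw [stdPDF_mul_bvnPDF ha hs, integral_const_mul]
    rw [integral_bvnPDF_quadrant (abs_tilt_lt_one ha hs) (Real.sqrt_pos.2 (by positivity)),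
      Real.sq_sqrt (by positivity)]
    set q := Real.sqrt (1 - (a ^ 2 * s) ^ 2)
    rw [← q32]
    field_simp
  · have h := (integrable_bvnPDF_quadrant hs).bdd_mul
      (c := (Real.sqrt (2 * Real.pi))⁻¹ * (Real.sqrt (2 * Real.pi))⁻¹)
      (f := fun q : ℝ × ℝ => stdPDF (a / Real.sqrt (1 - a ^ 2) * q.1) *
        stdPDF (a / Real.sqrt (1 - a ^ 2) * q.2)) ?_ (ae_of_all _ fun q => ?_)
    · exact h
    · have := continuous_stdPDF
      exact Continuous.aestronglyMeasurable (by fun_prop)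
    · have hb : ∀ x, stdPDF x ≤ (Real.sqrt (2 * Real.pi))⁻¹ := fun x => by
        unfold stdPDF
        refine mul_le_of_le_one_right (by positivity) (Real.exp_le_one_iff.2 ?_)
        have := sq_nonneg x; linarith
      rw [Real.norm_eq_abs, abs_mul, abs_of_pos (stdPDF_pos _), abs_of_pos (stdPDF_pos _)]
      exact mul_le_mul (hb _) (hb _) (stdPDF_pos _).le (by positivity)

end Tilt

/-- `sign x` times the conditional expectation of the sign of a standard normal variable with
correlation `k / √(1 + k²)` to another one, given the value `x` of the latter. -/
def signCorr (k x : ℝ) : ℝ := Real.sign x * (tail (-(k * x)) - tail (k * x))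

lemma integrable_two_mul_stdPDF (k : ℝ) :
    Integrable (fun t => 2 * k * stdPDF (k * t)) (volume.restrict (Ioi 0)) := by
  by_cases hk : k = 0
  · simp [hk]
  · exact ((integrable_stdPDF.comp_mul_left' hk).const_mul (2 * k)).restrict

/-- By Fubini, the product moment is a mixture of the probabilities
`P(|X| > u, |Y| > v)`. -/
lemma integral_signCorr_mul (k r : ℝ) :
    ∫ p, signCorr k p.1 * signCorr k p.2 ∂(bvn r) =
      ∫ q, 2 * k * stdPDF (k * q.1) * (2 * k * stdPDF (k * q.2)) *
        (bvn r).real {p | q.1 < |p.1| ∧ q.2 < |p.2|} ∂quadrantVolume := by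
  have hS : MeasurableSet {z : (ℝ × ℝ) × (ℝ × ℝ) | z.2.1 < |z.1.1| ∧ z.2.2 < |z.1.2|} :=
    (measurableSet_lt (f := fun z : (ℝ × ℝ) × (ℝ × ℝ) => z.2.1) (g := fun z => |z.1.1|)
      (by fun_prop) (by fun_prop)).inter
    (measurableSet_lt (f := fun z : (ℝ × ℝ) × (ℝ × ℝ) => z.2.2) (g := fun z => |z.1.2|)
      (by fun_prop) (by fun_prop))
  have hi := (integrable_two_mul_stdPDF k).mul_prod (integrable_two_mul_stdPDF k)
  have hint : Integrable (Function.uncurry fun (p q : ℝ × ℝ) =>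
      2 * k * stdPDF (k * q.1) * (2 * k * stdPDF (k * q.2)) *
        {z : (ℝ × ℝ) × (ℝ × ℝ) | z.2.1 < |z.1.1| ∧ z.2.2 < |z.1.2|}.indicator
          (1 : (ℝ × ℝ) × (ℝ × ℝ) → ℝ) (p, q))
      ((bvn r).prod quadrantVolume) := by
    have h2 := hi.comp_snd (bvn r)
    refine (h2.indicator hS).congr (ae_of_all _ fun z => ?_)
    by_cases hz : z.2.1 < |z.1.1| ∧ z.2.2 < |z.1.2| <;> simp [indicator, Function.uncurry, hz]
  have hswap := integral_integral_swap hint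
  have e1 : ∀ p : ℝ × ℝ, ∫ q, 2 * k * stdPDF (k * q.1) * (2 * k * stdPDF (k * q.2)) *
        {z : (ℝ × ℝ) × (ℝ × ℝ) | z.2.1 < |z.1.1| ∧ z.2.2 < |z.1.2|}.indicator
          (1 : (ℝ × ℝ) × (ℝ × ℝ) → ℝ) (p, q)
        ∂quadrantVolume = signCorr k p.1 * signCorr k p.2 := by
    intro p
    rw [signCorr, signCorr, ← integral_indicator_lt_abs, ← integral_indicator_lt_abs,
      quadrantVolume, ← integral_prod_mul]
    congr 1; ext q
    by_cases h1 : q.1 < |p.1| <;> by_cases h2 : q.2 < |p.2| <;> simp [indicator, h1, h2]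
  have e2 : ∀ q : ℝ × ℝ, ∫ p, 2 * k * stdPDF (k * q.1) * (2 * k * stdPDF (k * q.2)) *
        {z : (ℝ × ℝ) × (ℝ × ℝ) | z.2.1 < |z.1.1| ∧ z.2.2 < |z.1.2|}.indicator
          (1 : (ℝ × ℝ) × (ℝ × ℝ) → ℝ) (p, q)
        ∂(bvn r) = 2 * k * stdPDF (k * q.1) * (2 * k * stdPDF (k * q.2)) *
        (bvn r).real {p | q.1 < |p.1| ∧ q.2 < |p.2|} := by
    intro q
    have hq : MeasurableSet {p : ℝ × ℝ | q.1 < |p.1| ∧ q.2 < |p.2|} := measurable_prodMk_right hS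
    rw [integral_const_mul, ← integral_indicator_one hq]
    rfl
  simp_rw [e1, e2] at hswap
  exact hswap

lemma integrable_signCorr_kernel (k : ℝ) {r : ℝ} (hr : |r| < 1) :
    Integrable (Function.uncurry fun (s : ℝ) (q : ℝ × ℝ) =>
      2 * k * stdPDF (k * q.1) * (2 * k * stdPDF (k * q.2)) *
        (bvnPDF s q.1 q.2 - bvnPDF (-s) q.1 q.2))
      ((volume.restrict (uIoc 0 r)).prod quadrantVolume) := by
  have : IsFiniteMeasure (volume.restrict (uIoc 0 r)) := ⟨by simp [uIoc]⟩
  have hi := (((integrable_two_mul_stdPDF k).mul_prod (integrable_two_mul_stdPDF k)).comp_snd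
    (volume.restrict (uIoc 0 r)))
  have hb : ∀ s, |s| ≤ |r| → ∀ x y, |bvnPDF s x y| ≤
      (2 * Real.pi * Real.sqrt (1 - |r| ^ 2))⁻¹ := fun s hs x y => by
    rw [abs_of_pos (bvnPDF_pos (hs.trans_lt hr) _ _)]
    refine (bvnPDF_le hr hs x y).trans (mul_le_of_le_one_right (by positivity) ?_)
    rw [Real.exp_le_one_iff]
    have := sq_nonneg x; have := sq_nonneg y; linarith
  refine hi.mul_bdd (c := 2 * (2 * Real.pi * Real.sqrt (1 - |r| ^ 2))⁻¹)
    (g := fun z : ℝ × ℝ × ℝ => bvnPDF z.1 z.2.1 z.2.2 - bvnPDF (-z.1) z.2.1 z.2.2) ?_ ?_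
  · exact (measurable_bvnPDF.sub (measurable_bvnPDF.comp
      (by fun_prop : Measurable fun z : ℝ × ℝ × ℝ => (-z.1, z.2.1, z.2.2)))).aestronglyMeasurable
  · have h1 : ∀ᵐ s ∂(volume.restrict (uIoc 0 r)), |s| ≤ |r| := by
      filter_upwards [ae_restrict_mem measurableSet_uIoc] with s hs using abs_le_of_mem_uIoc hs
    filter_upwards [Measure.quasiMeasurePreserving_fst.ae h1] with z hz
    refine (norm_sub_le _ _).trans ?_
    have h2 := hb z.1 hz z.2.1 z.2.2
    have h3 := hb (-z.1) (by rwa [abs_neg]) z.2.1 z.2.2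
    simp only [Real.norm_eq_abs]
    linarith

/-- Plackett's identity for the product moment: it grows with the correlation at a rate given by a
quadrant probability. -/
lemma integral_signCorr_mul_sub {a b : ℝ} (ha : |a| < 1) (hb : |b| < 1) :
    ∫ p, signCorr (a / Real.sqrt (1 - a ^ 2)) p.1 * signCorr (a / Real.sqrt (1 - a ^ 2)) p.2
        ∂(bvn b) =
      ∫ p, signCorr (a / Real.sqrt (1 - a ^ 2)) p.1 * signCorr (a / Real.sqrt (1 - a ^ 2)) p.2
        ∂(bvn 0) +
      4 / Real.pi ^ 2 * ∫ s in (0 : ℝ)..b, a ^ 2 *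
        (Real.arcsin ((1 - a ^ 2) * s / (1 - a ^ 2 * s ^ 2)) *
          (1 / Real.sqrt (1 - (a ^ 2 * s) ^ 2))) := by
  have p4 := one_sub_sq_pos ha
  set k := a / Real.sqrt (1 - a ^ 2) with hk
  have hk2 : k ^ 2 = a ^ 2 / (1 - a ^ 2) := by rw [hk, div_pow, Real.sq_sqrt p4.le]
  have hswap := intervalIntegral_integral_swap (integrable_signCorr_kernel k hb)
  have hint := (integrable_signCorr_kernel k hb).integral_prod_right
  -- the inner integral over the quadrant
  have e1 : ∀ s ∈ uIcc 0 b, ∫ q, 2 * k * stdPDF (k * q.1) * (2 * k * stdPDF (k * q.2)) *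
        (bvnPDF s q.1 q.2 - bvnPDF (-s) q.1 q.2) ∂quadrantVolume =
      2 / Real.pi ^ 2 * (a ^ 2 * (Real.arcsin ((1 - a ^ 2) * s / (1 - a ^ 2 * s ^ 2)) *
          (1 / Real.sqrt (1 - (a ^ 2 * s) ^ 2)))) := by
    intro s hs
    have hs1 : |s| < 1 := (abs_le_of_mem_uIcc hs).trans_lt hb
    have hs2 : |-s| < 1 := by rwa [abs_neg]
    have i1 : ∀ s, |s| < 1 → Integrable (fun q : ℝ × ℝ => stdPDF (k * q.1) * stdPDF (k * q.2)
        * bvnPDF s q.1 q.2) quadrantVolume := fun s hs => by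
      refine (integrable_bvnPDF_quadrant hs).bdd_mul (c := 1) ?_ (ae_of_all _ fun q => ?_)
      · have := continuous_stdPDF
        exact Continuous.aestronglyMeasurable (by fun_prop)
      · have hb1 : ∀ x, stdPDF x ≤ 1 := fun x => by
          unfold stdPDF
          refine mul_le_one₀ (inv_le_one_of_one_le₀ ?_) (Real.exp_pos _).le
            (Real.exp_le_one_iff.2 ?_)
          · rw [Real.one_le_sqrt]; linarith [Real.pi_gt_three]
          · have := sq_nonneg x; linarith
        rw [Real.norm_eq_abs, abs_mul, abs_of_pos (stdPDF_pos _), abs_of_pos (stdPDF_pos _)]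
        exact mul_le_one₀ (hb1 _) (stdPDF_pos _).le (hb1 _)
    have e2 : ∀ q : ℝ × ℝ, 2 * k * stdPDF (k * q.1) * (2 * k * stdPDF (k * q.2)) *
        (bvnPDF s q.1 q.2 - bvnPDF (-s) q.1 q.2) =
        4 * k ^ 2 * (stdPDF (k * q.1) * stdPDF (k * q.2) * bvnPDF s q.1 q.2
          - stdPDF (k * q.1) * stdPDF (k * q.2) * bvnPDF (-s) q.1 q.2) := fun q => by ring
    simp_rw [e2]
    rw [integral_const_mul, integral_sub (i1 s hs1) (i1 (-s) hs2),
      integral_stdPDF_mul_bvnPDF ha hs1, integral_stdPDF_mul_bvnPDF ha hs2, hk2]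
    have e3 : (1 - a ^ 2) * -s / (1 - a ^ 2 * (-s) ^ 2) =
      -((1 - a ^ 2) * s / (1 - a ^ 2 * s ^ 2)) := by rw [neg_sq]; ring
    have e4 : (a ^ 2 * -s) ^ 2 = (a ^ 2 * s) ^ 2 := by ring
    rw [e3, e4, Real.arcsin_neg]
    have := Real.sqrt_pos.2 (one_sub_sq_pos (abs_sq_mul_lt_one ha hs1))
    field_simp; ring
  rw [intervalIntegral.integral_congr e1, intervalIntegral.integral_const_mul] at hswap
  -- the contribution of the product of the marginals
  have hT : ∀ r, |r| < 1 →
      ∫ p, signCorr k p.1 * signCorr k p.2 ∂(bvn r) =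
      ∫ q, (2 * k * stdPDF (k * q.1) * (2 * k * stdPDF (k * q.2)) * (4 * (tail q.1 * tail q.2)) +
        2 * ∫ s in (0 : ℝ)..r, 2 * k * stdPDF (k * q.1) * (2 * k * stdPDF (k * q.2)) *
        (bvnPDF s q.1 q.2 - bvnPDF (-s) q.1 q.2)) ∂quadrantVolume := by
    intro r hr
    rw [integral_signCorr_mul]
    refine integral_congr_ae ?_
    filter_upwards [ae_quadrantVolume] with q hq
    rw [bvn_real_abs hr hq.1.le hq.2.le, intervalIntegral.integral_const_mul]
    ring
  have i0 : Integrable (fun q : ℝ × ℝ => 2 * k * stdPDF (k * q.1) * (2 * k * stdPDF (k * q.2)) *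
      (4 * (tail q.1 * tail q.2))) quadrantVolume := by
    refine ((integrable_two_mul_stdPDF k).mul_prod (integrable_two_mul_stdPDF k)).mul_bdd
      (c := 4) ?_ (ae_of_all _ fun q => ?_)
    · have := continuous_tail
      exact Continuous.aestronglyMeasurable (by fun_prop)
    · rw [Real.norm_eq_abs, abs_of_nonneg
        (mul_nonneg zero_le_four (mul_nonneg (tail_nonneg _) (tail_nonneg _)))]
      have := mul_le_one₀ (tail_le_one q.1) (tail_nonneg q.2) (tail_le_one q.2)
      linarith
  have i1 : Integrable (fun q : ℝ × ℝ => ∫ s in (0 : ℝ)..b, 2 * k * stdPDF (k * q.1) *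
      (2 * k * stdPDF (k * q.2)) * (bvnPDF s q.1 q.2 - bvnPDF (-s) q.1 q.2)) quadrantVolume := by
    simp_rw [intervalIntegral.intervalIntegral_eq_integral_uIoc]
    exact hint.smul (if 0 ≤ b then (1 : ℝ) else -1)
  rw [hT b hb, hT 0 (by simp), integral_add i0 (i1.const_mul 2), integral_const_mul, ← hswap]
  simp only [intervalIntegral.integral_same, mul_zero, add_zero]
  ring

/-- The fourth-order sign moment in closed form. -/
theorem integral_signCorr_mul_eq {a b : ℝ} (ha : |a| < 1) (hb : |b| < 1) :
    ∫ p, signCorr (a / Real.sqrt (1 - a ^ 2)) p.1 * signCorr (a / Real.sqrt (1 - a ^ 2)) p.2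
        ∂(bvn b) =
      4 / Real.pi ^ 2 * (Real.arcsin a ^ 2 + chengI a (a ^ 2 * b)) := by
  have h0 : ∫ p, signCorr (a / Real.sqrt (1 - a ^ 2)) p.1 *
      signCorr (a / Real.sqrt (1 - a ^ 2)) p.2 ∂(bvn 0) = (2 / Real.pi * Real.arcsin a) ^ 2 := by
    have e : bvn 0 = (gaussianReal 0 1).prod (gaussianReal 0 1) := by
      simp [bvn]
    rw [e, integral_prod_mul, ← sq, ← integral_sign_mul_sign_bvn ha]
    congr 1
    have hm := measurable_sign
    rw [bvn, integral_map (measurable_bvn_map a).aemeasurable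
      (Measurable.aestronglyMeasurable (by fun_prop)), integral_prod]
    · simp_rw [integral_const_mul, integral_sign_gaussian ha]
      rfl
    · refine Integrable.of_bound (C := 1) (Measurable.aestronglyMeasurable (by fun_prop))
        (ae_of_all _ fun p => ?_)
      rw [Real.norm_eq_abs, abs_mul]
      exact mul_le_one₀ (abs_sign_le _) (abs_nonneg _) (abs_sign_le _)
  have hI : ∫ s in (0 : ℝ)..b, a ^ 2 *
        (Real.arcsin ((1 - a ^ 2) * s / (1 - a ^ 2 * s ^ 2)) *
          (1 / Real.sqrt (1 - (a ^ 2 * s) ^ 2))) = chengI a (a ^ 2 * b) := by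
    have h := intervalIntegral.smul_integral_comp_mul_left (a := 0) (b := b)
      (fun t => Real.arcsin ((1 - a ^ 2) * t / (a ^ 2 - t ^ 2)) * (1 / Real.sqrt (1 - t ^ 2)))
      (a ^ 2)
    rw [mul_zero] at h
    rw [chengI, ← h, smul_eq_mul, intervalIntegral.integral_const_mul]
    by_cases ha0 : a = 0
    · simp [ha0]
    · congr 1
      refine intervalIntegral.integral_congr fun s _ => ?_
      have e : (1 - a ^ 2) * (a ^ 2 * s) / (a ^ 2 - (a ^ 2 * s) ^ 2) =
          (1 - a ^ 2) * s / (1 - a ^ 2 * s ^ 2) := by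
        rw [show a ^ 2 - (a ^ 2 * s) ^ 2 = a ^ 2 * (1 - a ^ 2 * s ^ 2) by ring,
          show (1 - a ^ 2) * (a ^ 2 * s) = a ^ 2 * ((1 - a ^ 2) * s) by ring,
          mul_div_mul_left _ _ (pow_ne_zero 2 ha0)]
      simp only [e]
  rw [integral_signCorr_mul_sub ha hb, h0, hI]
  ring

/-! ### Orthant probabilities of Gaussian vectors -/

section CharFun

variable {Ω : Type*} [MeasurableSpace Ω] {P : Measure Ω} [IsProbabilityMeasure P] {n : ℕ}

lemma integral_cexp_multivariateGaussian {R : Matrix (Fin n) (Fin n) ℝ} (hR : R.PosSemidef)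
    (t : Fin n → ℝ) :
    ∫ x, Complex.exp (((∑ i, t i * x i : ℝ) : ℂ) * Complex.I) ∂(multivariateGaussian 0 R) =
      Complex.exp (((-(t ⬝ᵥ R.mulVec t) / 2 : ℝ) : ℂ)) := by
  have h := charFun_multivariateGaussian (μ := 0) hR (WithLp.toLp 2 t)
  rw [charFun_apply] at h
  simp only [PiLp.inner_apply, inner_zero_right] at h
  simpa [neg_div] using h

/-- A random vector with the characteristic function of a centred Gaussian vector has its law. -/
lemma map_eq_multivariateGaussian {R : Matrix (Fin n) (Fin n) ℝ} (hR : R.PosSemidef)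
    {Y : Ω → EuclideanSpace ℝ (Fin n)} (hY : AEMeasurable Y P)
    (h : ∀ t : Fin n → ℝ, ∫ ω, Complex.exp (((∑ i, t i * Y ω i : ℝ) : ℂ) * Complex.I) ∂P =
      Complex.exp (((-(t ⬝ᵥ R.mulVec t) / 2 : ℝ) : ℂ))) :
    P.map Y = multivariateGaussian 0 R := by
  have := Measure.isProbabilityMeasure_map hY
  refine Measure.ext_of_charFun ?_
  ext t
  rw [charFun_multivariateGaussian hR, charFun_apply,
    integral_map hY (by fun_prop)]
  simp only [PiLp.inner_apply, inner_zero_right]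
  simpa [neg_div] using h t

lemma integral_cexp_gaussianReal (t : ℝ) :
    ∫ x, Complex.exp (((t * x : ℝ) : ℂ) * Complex.I) ∂(gaussianReal 0 1) =
      Complex.exp (((-t ^ 2 / 2 : ℝ) : ℂ)) := by
  have h := charFun_gaussianReal (μ := 0) (v := 1) t
  rw [charFun_apply_real] at h
  simpa [neg_div] using h

lemma integral_cexp_bvn {r : ℝ} (hr : |r| < 1) (s t : ℝ) :
    ∫ p, Complex.exp (((s * p.1 + t * p.2 : ℝ) : ℂ) * Complex.I) ∂(bvn r) =
      Complex.exp (((-(s ^ 2 + 2 * r * s * t + t ^ 2) / 2 : ℝ) : ℂ)) := by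
  have hq := Real.sq_sqrt (one_sub_sq_pos hr).le
  rw [bvn, integral_map (measurable_bvn_map r).aemeasurable (by fun_prop)]
  have e : ∀ p : ℝ × ℝ, Complex.exp (((s * p.1 + t * (r * p.1 + Real.sqrt (1 - r ^ 2) * p.2) : ℝ)
      : ℂ) * Complex.I) = Complex.exp ((((s + t * r) * p.1 : ℝ) : ℂ) * Complex.I) *
      Complex.exp (((t * Real.sqrt (1 - r ^ 2) * p.2 : ℝ) : ℂ) * Complex.I) := fun p => by
    rw [← Complex.exp_add]; congr 1; push_cast; ring
  simp_rw [e]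
  rw [integral_prod_mul (fun x : ℝ => Complex.exp ((((s + t * r) * x : ℝ) : ℂ) * Complex.I))
    (fun x : ℝ => Complex.exp (((t * Real.sqrt (1 - r ^ 2) * x : ℝ) : ℂ) * Complex.I)),
    integral_cexp_gaussianReal, integral_cexp_gaussianReal, ← Complex.exp_add, ← Complex.ofReal_add]
  congr 2
  rw [mul_pow, hq]; ring

end CharFun

section Matrices

lemma dotProduct_Rplus_mulVec (a b : ℝ) (x : Fin 4 → ℝ) :
    x ⬝ᵥ (Rplus a b).mulVec x = (a * x 0 + x 1 + b * x 2 + a * b * x 3) ^ 2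
      + (1 - b ^ 2) * (x 2 + a * x 3) ^ 2 + (1 - a ^ 2) * x 0 ^ 2 + (1 - a ^ 2) * x 3 ^ 2 := by
  simp [Rplus, dotProduct, Matrix.mulVec, Fin.sum_univ_four]
  ring

lemma dotProduct_Rminus_mulVec (a b : ℝ) (x : Fin 4 → ℝ) :
    x ⬝ᵥ (Rminus a b).mulVec x = (-a * x 0 + x 1 + b * x 2 + a * b * x 3) ^ 2
      + (1 - b ^ 2) * (x 2 + a * x 3) ^ 2 + (1 - a ^ 2) * x 0 ^ 2 + (1 - a ^ 2) * x 3 ^ 2 := by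
  simp [Rminus, dotProduct, Matrix.mulVec, Fin.sum_univ_four]
  ring

variable {a b : ℝ}

/-- Both quadratic forms are sums of four squares, in which the variables can be eliminated one
after the other; `c = ± a`. -/
lemma sum_squares_pos (ha : |a| < 1) (hb : |b| < 1) (c : ℝ) {x : Fin 4 → ℝ} (hx : x ≠ 0) :
    0 < (c * x 0 + x 1 + b * x 2 + a * b * x 3) ^ 2
      + (1 - b ^ 2) * (x 2 + a * x 3) ^ 2 + (1 - a ^ 2) * x 0 ^ 2 + (1 - a ^ 2) * x 3 ^ 2 := by
  have pa := one_sub_sq_pos ha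
  have pb := one_sub_sq_pos hb
  by_cases h0 : x 0 = 0
  · by_cases h3 : x 3 = 0
    · by_cases h2 : x 2 = 0
      · have h1 : x 1 ≠ 0 := fun h1 => hx (by ext i; fin_cases i <;> simpa)
        rw [h0, h3, h2]
        have : 0 < x 1 ^ 2 := by positivity
        simpa using this
      · rw [h0, h3]
        have : 0 < (1 - b ^ 2) * x 2 ^ 2 := by positivity
        have := sq_nonneg (c * 0 + x 1 + b * x 2 + a * b * 0)
        simp only [mul_zero, add_zero] at *
        linarith [mul_nonneg pa.le (sq_nonneg (0 : ℝ))]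
    · have : 0 < (1 - a ^ 2) * x 3 ^ 2 := by positivity
      positivity
  · have : 0 < (1 - a ^ 2) * x 0 ^ 2 := by positivity
    positivity

theorem posDef_Rplus (ha : |a| < 1) (hb : |b| < 1) : (Rplus a b).PosDef := by
  refine Matrix.PosDef.of_dotProduct_mulVec_pos ?_ fun x hx => ?_
  · ext i j; fin_cases i <;> fin_cases j <;> simp [Rplus]
  · rw [star_trivial, dotProduct_Rplus_mulVec]
    exact sum_squares_pos ha hb a hx

theorem posDef_Rminus (ha : |a| < 1) (hb : |b| < 1) : (Rminus a b).PosDef := by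
  refine Matrix.PosDef.of_dotProduct_mulVec_pos ?_ fun x hx => ?_
  · ext i j; fin_cases i <;> fin_cases j <;> simp [Rminus]
  · rw [star_trivial, dotProduct_Rminus_mulVec]
    exact sum_squares_pos ha hb (-a) hx

end Matrices

section SignMoments

variable {n : ℕ} {R : Matrix (Fin n) (Fin n) ℝ}

lemma map_pair_multivariateGaussian (hR : R.PosSemidef) {i j : Fin n}
    (hi : R i i = 1) (hj : R j j = 1) (hij : |R i j| < 1) :
    (multivariateGaussian 0 R).map (fun x => (x i, x j)) = bvn (R i j) := by
  have hm : Measurable fun x : EuclideanSpace ℝ (Fin n) => (x i, x j) := by fun_prop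
  have := Measure.isProbabilityMeasure_map (μ := multivariateGaussian 0 R) hm.aemeasurable
  refine Measure.ext_of_charFunDual ?_
  ext L
  obtain ⟨s, t, hL⟩ : ∃ s t, ∀ p : ℝ × ℝ, L p = s * p.1 + t * p.2 := by
    refine ⟨L (1, 0), L (0, 1), fun p => ?_⟩
    have : p = p.1 • ((1 : ℝ), (0 : ℝ)) + p.2 • ((0 : ℝ), (1 : ℝ)) := by ext <;> simp
    conv_lhs => rw [this, map_add, map_smul, map_smul]
    simp [mul_comm]
  simp_rw [charFunDual_apply, hL]
  rw [integral_cexp_bvn hij, integral_map hm.aemeasurable (by fun_prop)]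
  have h := integral_cexp_multivariateGaussian hR (Pi.single i s + Pi.single j t)
  have e1 : ∀ x : EuclideanSpace ℝ (Fin n), ∑ k, (Pi.single i s + Pi.single j t : Fin n → ℝ) k * x k
      = s * x i + t * x j := fun x => by
    simp [add_mul, Finset.sum_add_distrib, Pi.single_apply]
  have hsym : R j i = R i j := by
    have := hR.isHermitian.apply i j
    simpa using this
  have e2 : (Pi.single i s + Pi.single j t : Fin n → ℝ) ⬝ᵥ
      R.mulVec (Pi.single i s + Pi.single j t) = s ^ 2 + 2 * R i j * s * t + t ^ 2 := by
    simp only [Matrix.mulVec_add, add_dotProduct, dotProduct_add, single_dotProduct,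
      Matrix.mulVec_single, Pi.smul_apply, Matrix.col_apply, hi, hj, hsym]
    simp
    ring
  simp_rw [e1, e2] at h
  exact h

/-- Sheppard's formula for two coordinates of a Gaussian vector. -/
lemma integral_sign_mul_sign (hR : R.PosSemidef) {i j : Fin n}
    (hi : R i i = 1) (hj : R j j = 1) (hij : |R i j| < 1) :
    ∫ x, Real.sign (x i) * Real.sign (x j) ∂(multivariateGaussian 0 R) =
      2 / Real.pi * Real.arcsin (R i j) := by
  have hm := measurable_sign
  rw [← integral_sign_mul_sign_bvn hij, ← map_pair_multivariateGaussian hR hi hj hij,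
    integral_map (by fun_prop) (Measurable.aestronglyMeasurable (by fun_prop))]

lemma map_neg_multivariateGaussian (hR : R.PosSemidef) :
    (multivariateGaussian 0 R).map (fun x => -x) = multivariateGaussian 0 R := by
  refine map_eq_multivariateGaussian hR (by fun_prop) fun t => ?_
  have h := integral_cexp_multivariateGaussian hR (-t)
  simpa [Matrix.mulVec_neg] using h

lemma ae_ne_zero_multivariateGaussian (hR : R.PosSemidef) (h1 : ∀ i, R i i = 1) :
    ∀ᵐ x ∂(multivariateGaussian 0 R), ∀ i, x i ≠ 0 := by
  refine ae_all_iff.2 fun i => ?_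
  have hp := measurePreserving_eval_multivariateGaussian (μ := 0) hR (i := i)
  have : ∀ᵐ y ∂(gaussianReal 0 1), y ≠ 0 := by
    have := nullSingletonClass_gaussianReal (μ := 0) one_ne_zero
    exact compl_mem_ae_iff.2 (measure_singleton 0)
  simp only [h1, Real.toNNReal_one, PiLp.zero_apply] at hp
  exact hp.quasiMeasurePreserving.ae this

end SignMoments

section Orthant

variable {R : Matrix (Fin 4) (Fin 4) ℝ}

/-- The fourth-order sign moment of a centred Gaussian vector with covariance matrix `R`. -/
def signMoment (R : Matrix (Fin 4) (Fin 4) ℝ) : ℝ :=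
  ∫ x, Real.sign (x 0) * Real.sign (x 1) * (Real.sign (x 2) * Real.sign (x 3))
    ∂(multivariateGaussian 0 R)

lemma integrable_sign_mul_sign (i j : Fin 4) :
    Integrable (fun x : EuclideanSpace ℝ (Fin 4) => Real.sign (x i) * Real.sign (x j))
      (multivariateGaussian 0 R) := by
  have hm := measurable_sign
  refine Integrable.of_bound (C := 1) (Measurable.aestronglyMeasurable (by fun_prop))
    (ae_of_all _ fun p => ?_)
  rw [Real.norm_eq_abs, abs_mul]
  exact mul_le_one₀ (abs_sign_le _) (abs_nonneg _) (abs_sign_le _)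

lemma integrable_sign_four :
    Integrable (fun x : EuclideanSpace ℝ (Fin 4) =>
      Real.sign (x 0) * Real.sign (x 1) * (Real.sign (x 2) * Real.sign (x 3)))
      (multivariateGaussian 0 R) := by
  have hm := measurable_sign
  refine Integrable.of_bound (C := 1) (Measurable.aestronglyMeasurable (by fun_prop))
    (ae_of_all _ fun p => ?_)
  rw [Real.norm_eq_abs, abs_mul, abs_mul, abs_mul]
  exact mul_le_one₀ (mul_le_one₀ (abs_sign_le _) (abs_nonneg _) (abs_sign_le _))
    (by positivity) (mul_le_one₀ (abs_sign_le _) (abs_nonneg _) (abs_sign_le _))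

/-- Every linear combination of the even sign moments, in terms of the correlations. -/
lemma integral_sign_polynomial (hR : R.PosSemidef) (h1 : ∀ i, R i i = 1)
    (h2 : ∀ i j, i ≠ j → |R i j| < 1) (c c01 c02 c03 c12 c13 c23 d : ℝ) :
    ∫ x, (c + c01 * (Real.sign (x 0) * Real.sign (x 1)) + c02 * (Real.sign (x 0) * Real.sign (x 2))
      + c03 * (Real.sign (x 0) * Real.sign (x 3)) + c12 * (Real.sign (x 1) * Real.sign (x 2))
      + c13 * (Real.sign (x 1) * Real.sign (x 3)) + c23 * (Real.sign (x 2) * Real.sign (x 3))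
      + d * (Real.sign (x 0) * Real.sign (x 1) * (Real.sign (x 2) * Real.sign (x 3))))
      ∂(multivariateGaussian 0 R) =
    c + 2 / Real.pi * (c01 * Real.arcsin (R 0 1) + c02 * Real.arcsin (R 0 2)
      + c03 * Real.arcsin (R 0 3) + c12 * Real.arcsin (R 1 2) + c13 * Real.arcsin (R 1 3)
      + c23 * Real.arcsin (R 2 3)) + d * signMoment R := by
  have i01 := (integrable_sign_mul_sign (R := R) 0 1).const_mul c01
  have i02 := (integrable_sign_mul_sign (R := R) 0 2).const_mul c02
  have i03 := (integrable_sign_mul_sign (R := R) 0 3).const_mul c03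
  have i12 := (integrable_sign_mul_sign (R := R) 1 2).const_mul c12
  have i13 := (integrable_sign_mul_sign (R := R) 1 3).const_mul c13
  have i23 := (integrable_sign_mul_sign (R := R) 2 3).const_mul c23
  have i4 := (integrable_sign_four (R := R)).const_mul d
  have ic : Integrable (fun _ : EuclideanSpace ℝ (Fin 4) => c) (multivariateGaussian 0 R) :=
    integrable_const c
  have s : ∀ i j, i ≠ j → ∫ x, Real.sign (x i) * Real.sign (x j) ∂(multivariateGaussian 0 R) =
      2 / Real.pi * Real.arcsin (R i j) := fun i j hij =>
    integral_sign_mul_sign hR (h1 i) (h1 j) (h2 i j hij)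
  rw [integral_add (by exact (((((ic.add i01).add i02).add i03).add i12).add i13).add i23) i4,
    integral_add (by exact ((((ic.add i01).add i02).add i03).add i12).add i13) i23,
    integral_add (by exact (((ic.add i01).add i02).add i03).add i12) i13,
    integral_add (by exact ((ic.add i01).add i02).add i03) i12,
    integral_add (by exact (ic.add i01).add i02) i03,
    integral_add (by exact ic.add i01) i02, integral_add ic i01]
  simp only [integral_const_mul]
  rw [s 0 1 (by decide), s 0 2 (by decide), s 0 3 (by decide), s 1 2 (by decide),
    s 1 3 (by decide), s 2 3 (by decide), signMoment]
  simp
  ring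

lemma measurableSet_pattern (e : Fin 4 → Fin 2) : MeasurableSet {x : EuclideanSpace ℝ (Fin 4) |
    ∀ i, (-1 : ℝ) ^ (e i : ℕ) * x i < 0} := by
  have : {x : EuclideanSpace ℝ (Fin 4) | ∀ i, (-1 : ℝ) ^ (e i : ℕ) * x i < 0} =
      ⋂ i, {x : EuclideanSpace ℝ (Fin 4) | (-1 : ℝ) ^ (e i : ℕ) * x i < 0} := by
    ext x; simp
  rw [this]
  exact MeasurableSet.iInter fun i => measurableSet_lt (by fun_prop) (by fun_prop)

/-- The product of the indicators of the half-lines selected by the pattern `e`, as a polynomial in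
the signs. -/
lemma indicator_pattern (e : Fin 4 → Fin 2) {x : Fin 4 → ℝ} (hx : ∀ i, x i ≠ 0) :
    {x : Fin 4 → ℝ | ∀ i, (-1 : ℝ) ^ (e i : ℕ) * x i < 0}.indicator 1 x =
      ∏ i, (1 - (-1) ^ (e i : ℕ) * Real.sign (x i)) / 2 := by
  have key : ∀ i, (1 - (-1) ^ (e i : ℕ) * Real.sign (x i)) / 2 =
      if (-1 : ℝ) ^ (e i : ℕ) * x i < 0 then 1 else 0 := by
    intro i
    generalize e i = k
    rcases lt_or_gt_of_ne (hx i) with h | h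
    · rw [Real.sign_of_neg h]
      fin_cases k <;> simp [h, h.le]
    · rw [Real.sign_of_pos h]
      fin_cases k <;> simp [h, h.le]
  simp_rw [key, Finset.prod_ite_zero, indicator]
  simp

/-- The orthant probabilities of a centred Gaussian vector with unit variances are determined by
its correlations and its fourth-order sign moment. -/
theorem gaussianOrthantProb_eq (hR : R.PosSemidef) (h1 : ∀ i, R i i = 1)
    (h2 : ∀ i j, i ≠ j → |R i j| < 1) (e : Fin 4 → Fin 2) {s0 s1 s2 s3 : ℝ}
    (e0 : (-1) ^ (e 0 : ℕ) = s0) (e1 : (-1) ^ (e 1 : ℕ) = s1)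
    (e2 : (-1) ^ (e 2 : ℕ) = s2) (e3 : (-1) ^ (e 3 : ℕ) = s3) :
    gaussianOrthantProb R e = (1 + 2 / Real.pi * (s0 * s1 * Real.arcsin (R 0 1)
      + s0 * s2 * Real.arcsin (R 0 2) + s0 * s3 * Real.arcsin (R 0 3)
      + s1 * s2 * Real.arcsin (R 1 2) + s1 * s3 * Real.arcsin (R 1 3)
      + s2 * s3 * Real.arcsin (R 2 3)) + s0 * s1 * s2 * s3 * signMoment R) / 16 := by
  have hm := measurable_sign
  set μ := multivariateGaussian 0 R with hμ
  set F : EuclideanSpace ℝ (Fin 4) → ℝ := fun x =>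
    ∏ i, (1 - (-1) ^ (e i : ℕ) * Real.sign (x i)) / 2 with hF
  have hFm : Measurable F := by
    rw [hF]; fun_prop
  have hFb : Integrable F μ := by
    refine Integrable.of_bound (C := 1) hFm.aestronglyMeasurable (ae_of_all _ fun x => ?_)
    rw [hF, Real.norm_eq_abs, Finset.abs_prod]
    refine Finset.prod_le_one (fun _ _ => abs_nonneg _) fun i _ => ?_
    rw [abs_div, abs_two, div_le_one two_pos]
    refine (abs_sub _ _).trans ?_
    have := abs_sign_le (x i)
    rw [abs_mul, abs_pow, abs_neg, abs_one, one_pow, one_mul]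
    linarith
  have hprob : gaussianOrthantProb R e = ∫ x, F x ∂μ := by
    rw [gaussianOrthantProb, signPatternProb, ← integral_indicator_one (measurableSet_pattern e)]
    refine integral_congr_ae ?_
    filter_upwards [ae_ne_zero_multivariateGaussian hR h1] with x hx
    exact indicator_pattern e (x := x) hx
  -- symmetrizing removes the moments of odd order
  have hneg : ∫ x, F x ∂μ = ∫ x, F (-x) ∂μ := by
    conv_lhs => rw [hμ, ← map_neg_multivariateGaussian hR,
      integral_map (by fun_prop) hFm.aestronglyMeasurable]
  have hFn : Integrable (fun x => F (-x)) μ := by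
    have h := hFb
    rw [hμ, ← map_neg_multivariateGaussian hR] at h
    exact (integrable_map_measure hFm.aestronglyMeasurable (by fun_prop)).1 h
  have hsum : ∫ x, F x ∂μ = (∫ x, (F x + F (-x)) ∂μ) / 2 := by
    rw [integral_add hFb hFn, ← hneg]; ring
  have hpoly := integral_sign_polynomial hR h1 h2 (1 / 8) (s0 * s1 / 8) (s0 * s2 / 8) (s0 * s3 / 8)
    (s1 * s2 / 8) (s1 * s3 / 8) (s2 * s3 / 8) (s0 * s1 * s2 * s3 / 8)
  have hpt : ∀ x, F x + F (-x) = 1 / 8 + s0 * s1 / 8 * (Real.sign (x 0) * Real.sign (x 1))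
      + s0 * s2 / 8 * (Real.sign (x 0) * Real.sign (x 2))
      + s0 * s3 / 8 * (Real.sign (x 0) * Real.sign (x 3))
      + s1 * s2 / 8 * (Real.sign (x 1) * Real.sign (x 2))
      + s1 * s3 / 8 * (Real.sign (x 1) * Real.sign (x 3))
      + s2 * s3 / 8 * (Real.sign (x 2) * Real.sign (x 3))
      + s0 * s1 * s2 * s3 / 8 *
        (Real.sign (x 0) * Real.sign (x 1) * (Real.sign (x 2) * Real.sign (x 3))) := by
    intro x
    simp only [hF, Fin.prod_univ_four, PiLp.neg_apply, Real.sign_neg, e0, e1, e2, e3]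
    ring
  rw [hprob, hsum]
  simp_rw [hpt]
  rw [hpoly]
  ring

end Orthant

section Model

variable {a b : ℝ}

lemma measurable_model (a : ℝ) : Measurable fun p : (ℝ × ℝ) × (ℝ × ℝ) =>
    (!₂[a * p.1.1 + Real.sqrt (1 - a ^ 2) * p.2.1, p.1.1, p.1.2,
      a * p.1.2 + Real.sqrt (1 - a ^ 2) * p.2.2] : EuclideanSpace ℝ (Fin 4)) := by
  refine (WithLp.measurable_toLp 2 _).comp (measurable_pi_iff.2 fun i => ?_)
  fin_cases i <;> simp <;> fun_prop

/-- A Gaussian vector with covariance matrix `R⁺` is a Markov chain: its outer coordinates are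
conditionally independent given the inner ones. -/
lemma map_model (ha : |a| < 1) (hb : |b| < 1) :
    ((bvn b).prod ((gaussianReal 0 1).prod (gaussianReal 0 1))).map
      (fun p => (!₂[a * p.1.1 + Real.sqrt (1 - a ^ 2) * p.2.1, p.1.1, p.1.2,
        a * p.1.2 + Real.sqrt (1 - a ^ 2) * p.2.2] : EuclideanSpace ℝ (Fin 4))) =
      multivariateGaussian 0 (Rplus a b) := by
  refine map_eq_multivariateGaussian (posDef_Rplus ha hb).posSemidef
    (measurable_model a).aemeasurable fun t => ?_
  have hq := Real.sq_sqrt (one_sub_sq_pos ha).le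
  set q := Real.sqrt (1 - a ^ 2)
  have e : ∀ p : (ℝ × ℝ) × (ℝ × ℝ), Complex.exp (((∑ i, t i *
      (!₂[a * p.1.1 + q * p.2.1, p.1.1, p.1.2, a * p.1.2 + q * p.2.2] : EuclideanSpace ℝ (Fin 4)) i
        : ℝ) : ℂ) * Complex.I) =
      Complex.exp ((((t 0 * a + t 1) * p.1.1 + (t 2 + t 3 * a) * p.1.2 : ℝ) : ℂ) * Complex.I) *
      (Complex.exp (((t 0 * q * p.2.1 : ℝ) : ℂ) * Complex.I) *
        Complex.exp (((t 3 * q * p.2.2 : ℝ) : ℂ) * Complex.I)) := fun p => by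
    rw [← Complex.exp_add, ← Complex.exp_add, ← add_mul, ← add_mul, ← Complex.ofReal_add,
      ← Complex.ofReal_add]
    congr 3
    simp [Fin.sum_univ_four]
    ring
  simp_rw [e]
  rw [integral_prod_mul (fun p : ℝ × ℝ => Complex.exp ((((t 0 * a + t 1) * p.1 +
      (t 2 + t 3 * a) * p.2 : ℝ) : ℂ) * Complex.I))
    (fun p : ℝ × ℝ => Complex.exp (((t 0 * q * p.1 : ℝ) : ℂ) * Complex.I) *
        Complex.exp (((t 3 * q * p.2 : ℝ) : ℂ) * Complex.I)),
    integral_prod_mul (fun x : ℝ => Complex.exp (((t 0 * q * x : ℝ) : ℂ) * Complex.I))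
      (fun x : ℝ => Complex.exp (((t 3 * q * x : ℝ) : ℂ) * Complex.I)),
    integral_cexp_bvn hb, integral_cexp_gaussianReal, integral_cexp_gaussianReal,
    ← Complex.exp_add, ← Complex.exp_add, ← Complex.ofReal_add, ← Complex.ofReal_add,
    dotProduct_Rplus_mulVec]
  congr 2
  rw [mul_pow, mul_pow, hq]
  ring

theorem signMoment_Rplus (ha : |a| < 1) (hb : |b| < 1) :
    signMoment (Rplus a b) =
      4 / Real.pi ^ 2 * (Real.arcsin a ^ 2 + chengI a (a ^ 2 * b)) := by
  have hm := measurable_sign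
  rw [← integral_signCorr_mul_eq ha hb, signMoment, ← map_model ha hb,
    integral_map (measurable_model a).aemeasurable
      (Measurable.aestronglyMeasurable (by fun_prop)), integral_prod]
  · congr 1; ext p
    simp only [signCorr, ← integral_sign_gaussian ha]
    rw [mul_mul_mul_comm, ← integral_prod_mul, ← integral_const_mul]
    congr 1; ext z
    simp
    ring
  · refine Integrable.of_bound (C := 1) (Measurable.aestronglyMeasurable ?_)
      (ae_of_all _ fun p => ?_)
    · have := measurable_model a
      fun_prop
    · rw [Real.norm_eq_abs, abs_mul, abs_mul, abs_mul]
      exact mul_le_one₀ (mul_le_one₀ (abs_sign_le _) (abs_nonneg _) (abs_sign_le _))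
        (by positivity) (mul_le_one₀ (abs_sign_le _) (abs_nonneg _) (abs_sign_le _))

/-- Changing the sign of the first coordinate turns `R⁺` into `R⁻`. -/
lemma signMoment_Rminus (ha : |a| < 1) (hb : |b| < 1) :
    signMoment (Rminus a b) = -signMoment (Rplus a b) := by
  have hm := measurable_sign
  have hmeas : Measurable fun x : EuclideanSpace ℝ (Fin 4) =>
      (!₂[-x 0, x 1, x 2, x 3] : EuclideanSpace ℝ (Fin 4)) := by
    refine (WithLp.measurable_toLp 2 _).comp (measurable_pi_iff.2 fun i => ?_)
    fin_cases i <;> simp <;> fun_prop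
  have hmap : (multivariateGaussian 0 (Rplus a b)).map (fun x =>
      (!₂[-x 0, x 1, x 2, x 3] : EuclideanSpace ℝ (Fin 4))) =
      multivariateGaussian 0 (Rminus a b) := by
    refine map_eq_multivariateGaussian (posDef_Rminus ha hb).posSemidef hmeas.aemeasurable
      fun t => ?_
    have h := integral_cexp_multivariateGaussian (posDef_Rplus ha hb).posSemidef
      ![-t 0, t 1, t 2, t 3]
    rw [dotProduct_Rplus_mulVec] at h
    rw [dotProduct_Rminus_mulVec]
    simpa [Fin.sum_univ_four] using h
  rw [signMoment, signMoment, ← hmap, integral_map hmeas.aemeasurable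
    (Measurable.aestronglyMeasurable (by fun_prop)), ← integral_neg]
  congr 1; ext x
  simp [Real.sign_neg]

lemma abs_entry_lt_one (ha : |a| < 1) (hb : |b| < 1) :
    |a * b| < 1 ∧ |a ^ 2 * b| < 1 := by
  refine ⟨?_, abs_sq_mul_lt_one ha hb⟩
  rw [abs_mul]
  exact mul_lt_one_of_nonneg_of_lt_one_left (abs_nonneg _) ha hb.le

lemma Rplus_diag (i : Fin 4) : Rplus a b i i = 1 := by fin_cases i <;> simp [Rplus]

lemma abs_Rplus_lt_one (ha : |a| < 1) (hb : |b| < 1) (i j : Fin 4) (hij : i ≠ j) :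
    |Rplus a b i j| < 1 := by
  obtain ⟨h1, h2⟩ := abs_entry_lt_one ha hb
  fin_cases i <;> fin_cases j <;> first
    | exact absurd rfl hij
    | simpa [Rplus] using ha
    | simpa [Rplus] using hb
    | simpa [Rplus] using h1
    | simpa [Rplus] using h2

lemma Rminus_diag (i : Fin 4) : Rminus a b i i = 1 := by fin_cases i <;> simp [Rminus]

lemma abs_Rminus_lt_one (ha : |a| < 1) (hb : |b| < 1) (i j : Fin 4) (hij : i ≠ j) :
    |Rminus a b i j| < 1 := by
  obtain ⟨h1, h2⟩ := abs_entry_lt_one ha hb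
  fin_cases i <;> fin_cases j <;> first
    | exact absurd rfl hij
    | simpa [Rminus] using ha
    | simpa [Rminus] using hb
    | simpa [Rminus] using h1
    | simpa [Rminus] using h2

theorem gaussianOrthantProb_Rplus (ha : |a| < 1) (hb : |b| < 1) :
    gaussianOrthantProb (Rplus a b) ![1, 1, 1, 1] = f a b := by
  rw [gaussianOrthantProb_eq (posDef_Rplus ha hb).posSemidef Rplus_diag (abs_Rplus_lt_one ha hb)
    ![1, 1, 1, 1] (s0 := -1) (s1 := -1) (s2 := -1) (s3 := -1) (by simp) (by simp) (by simp)
    (by simp), signMoment_Rplus ha hb, f]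
  simp [Rplus]
  field_simp
  ring

theorem gaussianOrthantProb_Rminus (ha : |a| < 1) (hb : |b| < 1) :
    gaussianOrthantProb (Rminus a b) ![1, 1, 1, 1] = g a b := by
  rw [gaussianOrthantProb_eq (posDef_Rminus ha hb).posSemidef Rminus_diag (abs_Rminus_lt_one ha hb)
    ![1, 1, 1, 1] (s0 := -1) (s1 := -1) (s2 := -1) (s3 := -1) (by simp) (by simp) (by simp)
    (by simp), signMoment_Rminus ha hb, signMoment_Rplus ha hb, g]
  simp [Rminus, Real.arcsin_neg]
  field_simp
  ring

end Model

/-! ### The law of four successive observations -/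

section Autoregression

variable {Ω : Type*} [MeasurableSpace Ω] {P : Measure Ω} {ρ : ℝ}
  {ε X : ℤ → Ω → ℝ}

/-- The characteristic function of a linear combination of independent standard normal
variables. -/
lemma integral_cexp_sum_iid {Z : ℕ → Ω → ℝ} (hZ : ∀ k, HasLaw (Z k) (gaussianReal 0 1) P)
    (hi : iIndepFun Z P) (w : ℕ → ℝ) (n : ℕ) :
    ∫ ω, Complex.exp (((∑ k ∈ Finset.range n, w k * Z k ω : ℝ) : ℂ) * Complex.I) ∂P =
      Complex.exp (((-(∑ k ∈ Finset.range n, w k ^ 2) / 2 : ℝ) : ℂ)) := by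
  have hm : ∀ k, AEMeasurable (fun ω => w k * Z k ω) P := fun k =>
    (hZ k).aemeasurable.const_mul _
  have hi2 : iIndepFun (fun k ω => w k * Z k ω) P :=
    hi.comp (fun k x => w k * x) fun k => by fun_prop
  have h := congrFun ((hi2.restrict _).charFun_map_fun_finsetSum_eq_prod
    (s := Finset.range n) fun k _ => hm k) 1
  have hms : AEMeasurable (fun ω => ∑ k ∈ Finset.range n, w k * Z k ω) P :=
    Finset.aemeasurable_fun_sum _ fun k _ => hm k
  rw [charFun_apply_real, integral_map hms (by fun_prop), Finset.prod_apply] at h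
  have hk : ∀ k, charFun (P.map fun ω => w k * Z k ω) 1 =
      Complex.exp (((-(w k ^ 2) / 2 : ℝ) : ℂ)) := fun k => by
    rw [charFun_map_mul_comp (hZ k).aemeasurable, (hZ k).map_eq, charFun_gaussianReal]
    simp [neg_div]
  simp_rw [hk] at h
  rw [← Complex.exp_sum, ← Complex.ofReal_sum] at h
  simp only [Complex.ofReal_one, one_mul] at h
  rw [h, ← Finset.sum_div, Finset.sum_neg_distrib]

lemma norm_cexp_mul_I_sub_le (x y : ℝ) :
    ‖Complex.exp ((x : ℂ) * Complex.I) - Complex.exp ((y : ℂ) * Complex.I)‖ ≤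
      min 2 |x - y| := by
  refine le_min ?_ ?_
  · refine (norm_sub_le _ _).trans ?_
    rw [Complex.norm_exp_ofReal_mul_I, Complex.norm_exp_ofReal_mul_I]; norm_num
  · have e : Complex.exp ((x : ℂ) * Complex.I) - Complex.exp ((y : ℂ) * Complex.I) =
        Complex.exp ((y : ℂ) * Complex.I) *
          (Complex.exp (Complex.I * ((x - y : ℝ) : ℂ)) - 1) := by
      rw [mul_sub, ← Complex.exp_add, mul_one]
      congr 2; push_cast; ring
    rw [e, norm_mul, Complex.norm_exp_ofReal_mul_I, one_mul]
    exact Real.norm_exp_I_mul_ofReal_sub_one_le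

lemma IsStationaryAR1.iterate (h : IsStationaryAR1 P ρ ε X) (n : ℕ) :
    ∀ᵐ ω ∂P, X 1 ω = ρ ^ n * X (1 - n) ω +
      Real.sqrt (1 - ρ ^ 2) * ∑ k ∈ Finset.range n, ρ ^ k * ε (1 - k) ω := by
  induction n with
  | zero => simp
  | succ n ih =>
    filter_upwards [ih, h.recursion (1 - n)] with ω h1 h2
    rw [h1, h2, Finset.sum_range_succ]
    have e : (1 : ℤ) - ((n + 1 : ℕ) : ℤ) = 1 - n - 1 := by push_cast; ring
    rw [e]
    ring

/-- `X_1` is standard normal and independent of the noise at the times `2`, `3`, `4`. Iterating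
the recursion `n` times into the past leaves the remainder `ρⁿ X_{1-n}`, which by stationarity has
the law of `ρⁿ X_1` and tends to zero in probability. -/
lemma IsStationaryAR1.integral_cexp [IsProbabilityMeasure P]
    (h : IsStationaryAR1 P ρ ε X) (hρ : |ρ| < 1)
    (s d2 d3 d4 : ℝ) :
    ∫ ω, Complex.exp (((s * X 1 ω + d2 * ε 2 ω + d3 * ε 3 ω + d4 * ε 4 ω : ℝ) : ℂ) *
      Complex.I) ∂P = Complex.exp (((-(s ^ 2 + d2 ^ 2 + d3 ^ 2 + d4 ^ 2) / 2 : ℝ) : ℂ)) := by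
  have hε : ∀ t, AEMeasurable (ε t) P := fun t => (h.noise_law t).aemeasurable
  have hX : ∀ t, Measurable (X t) := h.measurable
  set c := Real.sqrt (1 - ρ ^ 2) with hc
  have hc2 : c ^ 2 = 1 - ρ ^ 2 := Real.sq_sqrt (one_sub_sq_pos hρ).le
  set Y : ℕ → Ω → ℝ := fun n ω => c * ∑ k ∈ Finset.range n, ρ ^ k * ε (1 - k) ω with hY
  have hYm : ∀ n, AEMeasurable (Y n) P := fun n => by
    have : AEMeasurable (fun ω => ∑ k ∈ Finset.range n, ρ ^ k * ε (1 - k) ω) P :=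
      Finset.aemeasurable_fun_sum _ fun k _ => (hε _).const_mul _
    exact this.const_mul c
  set A : ℕ → ℂ := fun n => ∫ ω, Complex.exp (((s * Y n ω + d2 * ε 2 ω + d3 * ε 3 ω
    + d4 * ε 4 ω : ℝ) : ℂ) * Complex.I) ∂P with hA
  have hA1 : ∀ n, A n = Complex.exp
      (((-(s ^ 2 * (1 - (ρ ^ 2) ^ n) + d2 ^ 2 + d3 ^ 2 + d4 ^ 2) / 2 : ℝ) : ℂ)) := by
    intro n
    -- the noise in reversed time, starting from time `4`
    have hind : iIndepFun (fun (k : ℕ) => ε (4 - k)) P :=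
      h.noise_indep.precomp (g := fun k : ℕ => (4 : ℤ) - k) fun i j hij => by simpa using hij
    have := integral_cexp_sum_iid (fun k : ℕ => h.noise_law (4 - k)) hind
      (fun k => match k with
        | 0 => d4
        | 1 => d3
        | 2 => d2
        | k + 3 => s * c * ρ ^ k) (n + 3)
    simp only [Finset.sum_range_succ'] at this
    have e1 : ∀ k : ℕ, (4 : ℤ) - ((k + 1 + 1 + 1 : ℕ) : ℤ) = 1 - k := fun k => by push_cast; ring
    simp only [e1] at this
    rw [hA]
    convert this using 1
    · refine integral_congr_ae (ae_of_all _ fun ω => ?_)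
      simp only [hY, Finset.mul_sum]
      congr 3
      norm_num
      ring_nf
    · congr 3
      have hg := mul_neg_geom_sum (ρ ^ 2) n
      rw [← hc2] at hg
      have e2 : ∑ k ∈ Finset.range n, (s * c * ρ ^ k) ^ 2 =
          s ^ 2 * (c ^ 2 * ∑ k ∈ Finset.range n, (ρ ^ 2) ^ k) := by
        simp only [Finset.mul_sum]
        refine Finset.sum_congr rfl fun k _ => ?_
        ring
      rw [e2, hg]
  have hlim1 : Tendsto A atTop
      (𝓝 (Complex.exp (((-(s ^ 2 + d2 ^ 2 + d3 ^ 2 + d4 ^ 2) / 2 : ℝ) : ℂ)))) := by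
    have hp : Tendsto (fun n : ℕ => (ρ ^ 2) ^ n) atTop (𝓝 0) :=
      tendsto_pow_atTop_nhds_zero_of_lt_one (sq_nonneg ρ) ((sq_lt_one_iff_abs_lt_one ρ).2 hρ)
    have hcont : Continuous fun u : ℝ => Complex.exp
      (((-(s ^ 2 * (1 - u) + d2 ^ 2 + d3 ^ 2 + d4 ^ 2) / 2 : ℝ) : ℂ)) := by fun_prop
    have := (hcont.tendsto 0).comp hp
    simp only [sub_zero, mul_one] at this
    exact this.congr fun n => (hA1 n).symm
  have hlim2 : Tendsto A atTop (𝓝 (∫ ω, Complex.exp (((s * X 1 ω + d2 * ε 2 ω + d3 * ε 3 ω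
      + d4 * ε 4 ω : ℝ) : ℂ) * Complex.I) ∂P)) := by
    have hbound : ∀ n, ‖A n - ∫ ω, Complex.exp (((s * X 1 ω + d2 * ε 2 ω + d3 * ε 3 ω
        + d4 * ε 4 ω : ℝ) : ℂ) * Complex.I) ∂P‖ ≤ ∫ ω, min 2 |s * (ρ ^ n * X 1 ω)| ∂P := by
      intro n
      have i : ∀ Z : Ω → ℝ, AEMeasurable Z P → Integrable (fun ω => Complex.exp
          (((s * Z ω + d2 * ε 2 ω + d3 * ε 3 ω + d4 * ε 4 ω : ℝ) : ℂ) * Complex.I)) P :=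
        fun Z hZ => by
          refine Integrable.of_bound (C := 1) ?_ (ae_of_all _ fun ω => ?_)
          · have := hε 2; have := hε 3; have := hε 4
            exact AEMeasurable.aestronglyMeasurable (by fun_prop)
          · rw [Complex.norm_exp_ofReal_mul_I]
      have hst : ∫ ω, min 2 |s * (ρ ^ n * X 1 ω)| ∂P =
          ∫ ω, min 2 |s * (ρ ^ n * X (1 - n) ω)| ∂P := by
        have hid := (h.stationary (-n)).comp
          (u := fun x : ℤ → ℝ => min 2 |s * (ρ ^ n * x 1)|) (by fun_prop)
        exact hid.integral_eq.symm
      rw [hst, hA, ← integral_sub (i _ (hYm n)) (i _ (hX 1).aemeasurable)]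
      refine norm_integral_le_of_norm_le ?_ ?_
      · refine Integrable.of_bound (C := 2) ?_ (ae_of_all _ fun ω => ?_)
        · have := hX (1 - n)
          exact Measurable.aestronglyMeasurable (by fun_prop)
        · rw [Real.norm_eq_abs, abs_of_nonneg (by positivity)]
          exact min_le_left _ _
      · filter_upwards [h.iterate n] with ω hω
        refine (norm_cexp_mul_I_sub_le _ _).trans (le_of_eq ?_)
        rw [hω, abs_sub_comm]
        congr 2
        simp only [hY]
        ring
    have hz : Tendsto (fun n : ℕ => ∫ ω, min 2 |s * (ρ ^ n * X 1 ω)| ∂P) atTop (𝓝 0) := by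
      have hdct := tendsto_integral_of_dominated_convergence (μ := P)
        (F := fun (n : ℕ) ω => min 2 |s * (ρ ^ n * X 1 ω)|) (f := fun _ => 0) (fun _ => (2 : ℝ))
        (fun n => ?_) (integrable_const 2) (fun n => ae_of_all _ fun ω => ?_)
        (ae_of_all _ fun ω => ?_)
      · simpa using hdct
      · have := hX 1
        exact Measurable.aestronglyMeasurable (by fun_prop)
      · rw [Real.norm_eq_abs, abs_of_nonneg (by positivity)]
        exact min_le_left _ _
      · have hp := tendsto_pow_atTop_nhds_zero_of_abs_lt_one hρ
        have hcont : Continuous fun u : ℝ => min 2 |s * (u * X 1 ω)| := by fun_prop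
        have := (hcont.tendsto 0).comp hp
        simpa [Function.comp_def] using this
    rw [tendsto_iff_norm_sub_tendsto_zero]
    exact squeeze_zero (fun n => norm_nonneg _) hbound hz
  exact tendsto_nhds_unique hlim2 hlim1

lemma IsStationaryAR1.measurable_segment (h : IsStationaryAR1 P ρ ε X) : Measurable fun ω =>
    (WithLp.toLp 2 fun i => segment X 4 i ω : EuclideanSpace ℝ (Fin 4)) :=
  (WithLp.measurable_toLp 2 _).comp (measurable_pi_iff.2 fun _ => h.measurable _)

/-- Four successive observations form a Gaussian vector with covariance matrix
`R⁺(ρ, ρ) = (ρ^|i-j|)`. -/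
theorem IsStationaryAR1.map_segment [IsProbabilityMeasure P]
    (h : IsStationaryAR1 P ρ ε X) (hρ : |ρ| < 1) :
    P.map (fun ω => (WithLp.toLp 2 fun i => segment X 4 i ω : EuclideanSpace ℝ (Fin 4))) =
      multivariateGaussian 0 (Rplus ρ ρ) := by
  refine map_eq_multivariateGaussian (posDef_Rplus hρ hρ).posSemidef
    h.measurable_segment.aemeasurable fun t => ?_
  have hq := Real.sq_sqrt (one_sub_sq_pos hρ).le
  set c := Real.sqrt (1 - ρ ^ 2) with hc
  have hchar := h.integral_cexp hρ (t 0 + ρ * t 1 + ρ ^ 2 * t 2 + ρ ^ 3 * t 3)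
    (c * (t 1 + ρ * t 2 + ρ ^ 2 * t 3)) (c * (t 2 + ρ * t 3)) (c * t 3)
  convert! hchar using 1
  · refine integral_congr_ae ?_
    filter_upwards [h.recursion 2, h.recursion 3, h.recursion 4] with ω h2 h3 h4
    norm_num at h2 h3 h4
    congr 3
    have e0 : segment X 4 0 ω = X 1 ω := by simp [segment]
    have e1 : segment X 4 1 ω = X 2 ω := by simp [segment]
    have e2 : segment X 4 2 ω = X 3 ω := by simp [segment]
    have e3 : segment X 4 3 ω = X 4 ω := by simp [segment]
    simp only [Fin.sum_univ_four, e0, e1, e2, e3]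
    rw [h4, h3, h2, ← hc]
    ring
  · congr 2
    rw [dotProduct_Rplus_mulVec, mul_pow, mul_pow, mul_pow, hq]
    ring

end Autoregression

/-! ### Sign patterns and sign changes -/

section Parity

lemma chengI_neg_left (h x : ℝ) : chengI (-h) x = chengI h x := by simp [chengI]

/-- The integrand is odd, so its primitive is even. -/
lemma chengI_neg_right (h x : ℝ) : chengI h (-x) = chengI h x := by
  have e := intervalIntegral.integral_comp_neg (a := 0) (b := x) (fun t =>
    Real.arcsin ((1 - h ^ 2) * t / (h ^ 2 - t ^ 2)) * (1 / Real.sqrt (1 - t ^ 2)))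
  have o : ∀ t : ℝ, Real.arcsin ((1 - h ^ 2) * -t / (h ^ 2 - (-t) ^ 2)) *
      (1 / Real.sqrt (1 - (-t) ^ 2)) =
      -(Real.arcsin ((1 - h ^ 2) * t / (h ^ 2 - t ^ 2)) * (1 / Real.sqrt (1 - t ^ 2))) :=
    fun t => by rw [neg_sq, mul_neg, neg_div, Real.arcsin_neg, neg_mul]
  simp only [o, neg_zero, intervalIntegral.integral_neg] at e
  rw [chengI, chengI, intervalIntegral.integral_symm, ← e, neg_neg]

end Parity

/-- The number of sign changes as a polynomial in the signs, for a vector without zeros. -/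
lemma signChanges_eq {Ω : Type*} {X : ℤ → Ω → ℝ} (ω : Ω) (h0 : ∀ i, segment X 4 i ω ≠ 0) :
    (signChanges X 4 ω : ℝ) =
      3 / 2 - (Real.sign (segment X 4 0 ω) * Real.sign (segment X 4 1 ω)
        + Real.sign (segment X 4 1 ω) * Real.sign (segment X 4 2 ω)
        + Real.sign (segment X 4 2 ω) * Real.sign (segment X 4 3 ω)) / 2 := by
  have key : ∀ x y : ℝ, x ≠ 0 → y ≠ 0 → (if x * y < 0 then (1 : ℝ) else 0) =
      (1 - Real.sign x * Real.sign y) / 2 := by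
    intro x y hx hy
    rcases lt_or_gt_of_ne hx with h | h <;> rcases lt_or_gt_of_ne hy with h' | h'
    · rw [Real.sign_of_neg h, Real.sign_of_neg h', if_neg (mul_pos_of_neg_of_neg h h').not_gt]
      norm_num
    · rw [Real.sign_of_neg h, Real.sign_of_pos h', if_pos (mul_neg_of_neg_of_pos h h')]
      norm_num
    · rw [Real.sign_of_pos h, Real.sign_of_neg h', if_pos (mul_neg_of_pos_of_neg h h')]
      norm_num
    · rw [Real.sign_of_pos h, Real.sign_of_pos h', if_neg (mul_pos h h').not_gt]
      norm_num
  have e0 : segment X 4 0 ω = X 1 ω := by simp [segment]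
  have e1 : segment X 4 1 ω = X 2 ω := by simp [segment]
  have e2 : segment X 4 2 ω = X 3 ω := by simp [segment]
  have e3 : segment X 4 3 ω = X 4 ω := by simp [segment]
  have n1 := e0 ▸ h0 0
  have n2 := e1 ▸ h0 1
  have n3 := e2 ▸ h0 2
  have n4 := e3 ▸ h0 3
  have hI : Finset.Ico (1 : ℤ) ((4 : ℕ) : ℤ) = {1, 2, 3} := by decide
  rw [signChanges, hI, Finset.card_filter, Finset.sum_insert (by decide),
    Finset.sum_insert (by decide), Finset.sum_singleton]
  push_cast
  norm_num only
  rw [key _ _ n1 n2, key _ _ n2 n3, key _ _ n3 n4, e0, e1, e2, e3]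
  ring

section Autoregression

variable {Ω : Type*} [MeasurableSpace Ω] {P : Measure Ω} {ρ : ℝ} {ε X : ℤ → Ω → ℝ}

lemma IsStationaryAR1.signPatternProb_eq [IsProbabilityMeasure P]
    (h : IsStationaryAR1 P ρ ε X) (hρ : |ρ| < 1)
    (e : Fin 4 → Fin 2) {s0 s1 s2 s3 : ℝ}
    (e0 : (-1) ^ (e 0 : ℕ) = s0) (e1 : (-1) ^ (e 1 : ℕ) = s1)
    (e2 : (-1) ^ (e 2 : ℕ) = s2) (e3 : (-1) ^ (e 3 : ℕ) = s3) :
    signPatternProb P (segment X 4) e =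
      (1 + 2 / Real.pi * ((s0 * s1 + s1 * s2 + s2 * s3) * Real.arcsin ρ
        + (s0 * s2 + s1 * s3) * Real.arcsin (ρ * ρ) + s0 * s3 * Real.arcsin (ρ ^ 2 * ρ))
        + s0 * s1 * s2 * s3 *
          (4 / Real.pi ^ 2 * (Real.arcsin ρ ^ 2 + chengI ρ (ρ ^ 2 * ρ)))) / 16 := by
  have h1 : signPatternProb P (segment X 4) e = gaussianOrthantProb (Rplus ρ ρ) e := by
    rw [gaussianOrthantProb, signPatternProb, signPatternProb, ← h.map_segment hρ,
      map_measureReal_apply h.measurable_segment (measurableSet_pattern e)]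
    rfl
  rw [h1, gaussianOrthantProb_eq (posDef_Rplus hρ hρ).posSemidef Rplus_diag
    (abs_Rplus_lt_one hρ hρ) e e0 e1 e2 e3, signMoment_Rplus hρ hρ]
  simp [Rplus]
  ring

lemma IsStationaryAR1.signChanges_ae_eq [IsProbabilityMeasure P]
    (h : IsStationaryAR1 P ρ ε X) (hρ : |ρ| < 1) :
    ∀ᵐ ω ∂P, (∀ i, segment X 4 i ω ≠ 0) ∧ (signChanges X 4 ω : ℝ) =
      3 / 2 - (Real.sign (segment X 4 0 ω) * Real.sign (segment X 4 1 ω)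
        + Real.sign (segment X 4 1 ω) * Real.sign (segment X 4 2 ω)
        + Real.sign (segment X 4 2 ω) * Real.sign (segment X 4 3 ω)) / 2 := by
  have h0 := ae_ne_zero_multivariateGaussian (posDef_Rplus hρ hρ).posSemidef
    (Rplus_diag (a := ρ) (b := ρ))
  rw [← h.map_segment hρ] at h0
  filter_upwards [ae_of_ae_map h.measurable_segment.aemeasurable h0] with ω hω
  exact ⟨hω, signChanges_eq ω hω⟩

lemma IsStationaryAR1.memLp_signChanges [IsProbabilityMeasure P]
    (h : IsStationaryAR1 P ρ ε X) (hρ : |ρ| < 1) :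
    MemLp (fun ω => (signChanges X 4 ω : ℝ)) 2 P := by
  have hs := measurable_sign
  have hX : ∀ i, Measurable (segment X 4 i) := fun i => h.measurable _
  have h0 := hX 0; have h1 := hX 1; have h2 := hX 2; have h3 := hX 3
  refine MemLp.of_bound (C := 3) ?_ (ae_of_all _ fun ω => ?_)
  · have hm : Measurable fun ω =>
        3 / 2 - (Real.sign (segment X 4 0 ω) * Real.sign (segment X 4 1 ω)
        + Real.sign (segment X 4 1 ω) * Real.sign (segment X 4 2 ω)
        + Real.sign (segment X 4 2 ω) * Real.sign (segment X 4 3 ω)) / 2 := by fun_prop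
    refine hm.aestronglyMeasurable.congr ?_
    filter_upwards [h.signChanges_ae_eq hρ] with ω hω using hω.2.symm
  · rw [Real.norm_eq_abs, Nat.abs_cast]
    have : signChanges X 4 ω ≤ 3 := (Finset.card_filter_le _ _).trans (by simp)
    exact_mod_cast this

lemma IsStationaryAR1.integral_sign_polynomial [IsProbabilityMeasure P]
    (h : IsStationaryAR1 P ρ ε X) (hρ : |ρ| < 1)
    (c c01 c02 c12 c13 c23 d : ℝ) :
    ∫ ω, (c + c01 * (Real.sign (segment X 4 0 ω) * Real.sign (segment X 4 1 ω))
      + c02 * (Real.sign (segment X 4 0 ω) * Real.sign (segment X 4 2 ω))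
      + 0 * (Real.sign (segment X 4 0 ω) * Real.sign (segment X 4 3 ω))
      + c12 * (Real.sign (segment X 4 1 ω) * Real.sign (segment X 4 2 ω))
      + c13 * (Real.sign (segment X 4 1 ω) * Real.sign (segment X 4 3 ω))
      + c23 * (Real.sign (segment X 4 2 ω) * Real.sign (segment X 4 3 ω))
      + d * (Real.sign (segment X 4 0 ω) * Real.sign (segment X 4 1 ω) *
        (Real.sign (segment X 4 2 ω) * Real.sign (segment X 4 3 ω)))) ∂P =
    c + 2 / Real.pi * ((c01 + c12 + c23) * Real.arcsin ρ + (c02 + c13) * Real.arcsin (ρ * ρ))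
      + d * (4 / Real.pi ^ 2 * (Real.arcsin ρ ^ 2 + chengI ρ (ρ ^ 2 * ρ))) := by
  have hs := measurable_sign
  have h1 := AROne.integral_sign_polynomial (posDef_Rplus hρ hρ).posSemidef Rplus_diag
    (abs_Rplus_lt_one hρ hρ) c c01 c02 0 c12 c13 c23 d
  rw [signMoment_Rplus hρ hρ, ← h.map_segment hρ, integral_map h.measurable_segment.aemeasurable
    (Measurable.aestronglyMeasurable (by fun_prop))] at h1
  refine h1.trans ?_
  simp [Rplus]
  ring

theorem IsStationaryAR1.integral_signChanges [IsProbabilityMeasure P]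
    (h : IsStationaryAR1 P ρ ε X) (hρ : |ρ| < 1) :
    ∫ ω, (signChanges X 4 ω : ℝ) ∂P = 3 / 2 - 3 / Real.pi * Real.arcsin ρ := by
  have h1 := h.integral_sign_polynomial hρ (3 / 2) (-1 / 2) 0 (-1 / 2) 0 (-1 / 2) 0
  have h2 : ∫ ω, (signChanges X 4 ω : ℝ) ∂P = _ := (integral_congr_ae (by
    filter_upwards [h.signChanges_ae_eq hρ] with ω hω
    rw [hω.2]
    ring)).trans h1
  rw [h2]
  ring

theorem IsStationaryAR1.integral_signChanges_sq [IsProbabilityMeasure P]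
    (h : IsStationaryAR1 P ρ ε X) (hρ : |ρ| < 1) :
    ∫ ω, (signChanges X 4 ω : ℝ) ^ 2 ∂P = 3 - 9 / Real.pi * Real.arcsin ρ
      + 2 / Real.pi * Real.arcsin (ρ * ρ)
      + 2 / Real.pi ^ 2 * (Real.arcsin ρ ^ 2 + chengI ρ (ρ ^ 2 * ρ)) := by
  have h1 := h.integral_sign_polynomial hρ 3 (-3 / 2) (1 / 2) (-3 / 2) (1 / 2) (-3 / 2) (1 / 2)
  have sq : ∀ x : ℝ, x ≠ 0 → Real.sign x ^ 2 = 1 := fun x hx => by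
    rcases Real.sign_apply_eq_of_ne_zero x hx with h | h <;> simp [h]
  have h2 : ∫ ω, (signChanges X 4 ω : ℝ) ^ 2 ∂P = _ := (integral_congr_ae (by
    filter_upwards [h.signChanges_ae_eq hρ] with ω hω
    rw [hω.2]
    have q0 := sq _ (hω.1 0)
    have q1 := sq _ (hω.1 1)
    have q2 := sq _ (hω.1 2)
    have q3 := sq _ (hω.1 3)
    generalize Real.sign (segment X 4 0 ω) = x0 at q0 ⊢
    generalize Real.sign (segment X 4 1 ω) = x1 at q1 ⊢
    generalize Real.sign (segment X 4 2 ω) = x2 at q2 ⊢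
    generalize Real.sign (segment X 4 3 ω) = x3 at q3 ⊢
    -- expand the square and reduce by `xᵢ² = 1`
    linear_combination (1 / 4) * x1 ^ 2 * q0 + (1 / 4) * q1 + (1 / 4) * x2 ^ 2 * q1
      + (1 / 4) * q2 + (1 / 4) * x3 ^ 2 * q2 + (1 / 4) * q3 + (1 / 2) * x0 * x2 * q1
      + (1 / 2) * x1 * x3 * q2)).trans h1
  rw [h2]
  ring

end Autoregression

end AROne

end

theorem mainTheorem2 :
    -- the orthant probabilities of the structured covariance matrices
    (∀ a b : ℝ, |a| < 1 → |b| < 1 →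
      (AROne.Rplus a b).PosDef ∧
      AROne.gaussianOrthantProb (AROne.Rplus a b) ![1, 1, 1, 1] = AROne.f a b ∧
      (AROne.Rminus a b).PosDef ∧
      AROne.gaussianOrthantProb (AROne.Rminus a b) ![1, 1, 1, 1] = AROne.g a b) ∧
    -- the segment of length four of the autoregressive process
    (∀ {Ω : Type*} [MeasurableSpace Ω] (P : Measure Ω) [IsProbabilityMeasure P]
      (ρ : ℝ) (ε X : ℤ → Ω → ℝ), |ρ| < 1 → AROne.IsStationaryAR1 P ρ ε X →
      let p : (Fin 4 → Fin 2) → ℝ := AROne.signPatternProb P (AROne.segment X 4)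
      let S : Ω → ℝ := fun ω => (AROne.signChanges X 4 ω : ℝ)
      -- the sixteen sign patterns
      (p ![1, 1, 1, 1] = AROne.f ρ ρ ∧ p ![0, 0, 0, 0] = AROne.f ρ ρ) ∧
      (p ![1, 0, 0, 0] = AROne.g ρ ρ ∧ p ![0, 1, 1, 1] = AROne.g ρ ρ ∧
        AROne.g ρ ρ = AROne.g (-ρ) ρ ∧
        p ![0, 0, 0, 1] = AROne.g (-ρ) ρ ∧ p ![1, 1, 1, 0] = AROne.g (-ρ) ρ) ∧
      (p ![0, 1, 0, 0] = AROne.g ρ (-ρ) ∧ p ![1, 0, 1, 1] = AROne.g ρ (-ρ) ∧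
        AROne.g ρ (-ρ) = AROne.g (-ρ) (-ρ) ∧
        p ![0, 0, 1, 0] = AROne.g (-ρ) (-ρ) ∧ p ![1, 1, 0, 1] = AROne.g (-ρ) (-ρ)) ∧
      (p ![1, 1, 0, 0] = AROne.f ρ (-ρ) ∧ p ![0, 0, 1, 1] = AROne.f ρ (-ρ)) ∧
      (p ![0, 1, 1, 0] = AROne.f (-ρ) ρ ∧ p ![1, 0, 0, 1] = AROne.f (-ρ) ρ) ∧
      (p ![1, 0, 1, 0] = AROne.f (-ρ) (-ρ) ∧ p ![0, 1, 0, 1] = AROne.f (-ρ) (-ρ)) ∧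
      -- expectation and variance of the number of sign changes
      MemLp S 2 P ∧
      (∫ ω, S ω ∂P = 4 * AROne.g ρ ρ + 2 * AROne.f ρ (-ρ) + 8 * AROne.g ρ (-ρ)
          + 4 * AROne.f (-ρ) ρ + 6 * AROne.f (-ρ) (-ρ)) ∧
      (∫ ω, S ω ∂P = 3 * Real.arccos ρ / Real.pi) ∧
      (variance S P = 4 * AROne.g ρ ρ + 2 * AROne.f ρ (-ρ) + 16 * AROne.g ρ (-ρ)
          + 8 * AROne.f (-ρ) ρ + 18 * AROne.f (-ρ) (-ρ)
          - 9 * (1 / 2 - Real.arcsin ρ / Real.pi) ^ 2)) := by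
  refine ⟨fun a b ha hb => ⟨AROne.posDef_Rplus ha hb, AROne.gaussianOrthantProb_Rplus ha hb,
    AROne.posDef_Rminus ha hb, AROne.gaussianOrthantProb_Rminus ha hb⟩, ?_⟩
  intro Ω _ P _ ρ ε X hρ h p S
  -- the closed forms at the four sign combinations, with all arguments reduced to powers of `ρ`
  have f2 : AROne.f ρ (-ρ) = 1 / 16 + (2 * Real.arcsin ρ - Real.arcsin ρ
      - 2 * Real.arcsin (ρ * ρ) - Real.arcsin (ρ ^ 2 * ρ)) / (8 * Real.pi)
      + (Real.arcsin ρ ^ 2 + AROne.chengI ρ (ρ ^ 2 * ρ)) / (4 * Real.pi ^ 2) := by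
    simp only [AROne.f, mul_neg, Real.arcsin_neg, AROne.chengI_neg_right]; ring
  have f3 : AROne.f (-ρ) ρ = 1 / 16 + (-2 * Real.arcsin ρ + Real.arcsin ρ
      - 2 * Real.arcsin (ρ * ρ) + Real.arcsin (ρ ^ 2 * ρ)) / (8 * Real.pi)
      + (Real.arcsin ρ ^ 2 + AROne.chengI ρ (ρ ^ 2 * ρ)) / (4 * Real.pi ^ 2) := by
    simp only [AROne.f, neg_mul, neg_sq, Real.arcsin_neg, AROne.chengI_neg_left]; ring
  have f4 : AROne.f (-ρ) (-ρ) = 1 / 16 + (-2 * Real.arcsin ρ - Real.arcsin ρ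
      + 2 * Real.arcsin (ρ * ρ) - Real.arcsin (ρ ^ 2 * ρ)) / (8 * Real.pi)
      + (Real.arcsin ρ ^ 2 + AROne.chengI ρ (ρ ^ 2 * ρ)) / (4 * Real.pi ^ 2) := by
    simp only [AROne.f, mul_neg, neg_mul, neg_neg, neg_sq, Real.arcsin_neg, AROne.chengI_neg_left,
      AROne.chengI_neg_right]
    ring
  have g2 : AROne.g ρ (-ρ) = 1 / 16 - (Real.arcsin ρ - Real.arcsin (ρ ^ 2 * ρ)) / (8 * Real.pi)
      - (Real.arcsin ρ ^ 2 + AROne.chengI ρ (ρ ^ 2 * ρ)) / (4 * Real.pi ^ 2) := by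
    simp only [AROne.g, mul_neg, Real.arcsin_neg, AROne.chengI_neg_right]; ring
  have g13 : ∀ b, AROne.g ρ b = AROne.g (-ρ) b := fun b => by
    simp only [AROne.g, neg_sq, Real.arcsin_neg, AROne.chengI_neg_left]
  rw [← g13, ← g13]
  have hp : ∀ e : Fin 4 → Fin 2, p e = _ := fun e => h.signPatternProb_eq hρ e rfl rfl rfl rfl
  have hE := h.integral_signChanges hρ
  have hE2 := h.integral_signChanges_sq hρ
  have hL := h.memLp_signChanges hρ
  have hV : variance S P = ∫ ω, (AROne.signChanges X 4 ω : ℝ) ^ 2 ∂P -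
      (∫ ω, (AROne.signChanges X 4 ω : ℝ) ∂P) ^ 2 := variance_eq_sub hL
  rw [hE, hE2] at hV
  have hpi := Real.pi_pos
  refine ⟨⟨?_, ?_⟩, ⟨?_, ?_, rfl, ?_, ?_⟩, ⟨?_, ?_, rfl, ?_, ?_⟩, ⟨?_, ?_⟩, ⟨?_, ?_⟩, ⟨?_, ?_⟩,
    hL, hE.trans ?mean, hE.trans ?arccos, hV.trans ?var⟩
  case mean => rw [f2, f3, f4, g2, AROne.g]; field_simp; ring
  case arccos => rw [Real.arccos]; field_simp
  case var => rw [f2, f3, f4, g2, AROne.g]; field_simp; ring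
  all_goals
    rw [hp]
    first | rw [f2] | rw [f3] | rw [f4] | rw [g2] | rw [AROne.f] | rw [AROne.g]
    simp
    field_simp
    ring
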